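/- Let $\Omega=(0,1)^{\mathbb Z}$ with the product $\sigma$-algebra, write $\omega=(\omega_x^+)_{x\in\mathbb Z}\in\Omega$ and $\omega_x^-:=1-\omega_x^+$. For $\lambda\in\mathbb R$ set $$\omega_x^{\pm}(\lambda):=\frac{\omega_x^{\pm}e^{\pm\lambda}}{\omega_x^-e^{-\lambda}+\omega_x^+e^{\lambda}},\qquad \rho_x(\lambda):=\frac{\omega_x^-(\lambda)}{\omega_x^+(\lambda)},\qquad \rho_x:=\rho_x(0),$$ and let $P_0^{\omega,\lambda}$ be the law of the discrete-time Markov chain $(X_n)_{n\ge 0}$ on $\mathbb Z$ with $X_0=0$ that jumps from $x$ to $x\pm1$ with probability $\omega_x^{\pm}(\lambda)$. Let $\mathbb P$ be a probability measure on $\Omega$, with expectation $\mathbb E$, which is stationary and ergodic with respect to shifts, and such that $\mathbb E[\log\rho_0]$ is well defined, with $\pm\infty$ as possible values. Suppose moreover that $\mathbb P$ is reflection invariant, i.e. invariant under the map $(\omega_x^+)_{x\in\mathbb Z}\mapsto(\omega_{-x}^-)_{x\in\mathbb Z}$. Define the $[0,\infty]$-valued random variable $$\bar S(\lambda):=\frac1{\omega_0^+(\lambda)}+\sum_{i=1}^\infty\frac1{\omega_{-i}^+(\lambda)}\prod_{j=0}^{i-1}\rho_{-j}(\lambda).$$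 Then for every $\lambda\in\mathbb R$ the limit $v_X(\lambda):=\lim_{n\to\infty}X_n/n$ exists $\mathbb P\otimes P_0^{\omega,\lambda}$-almost surely and is a non-random real number, and for every $\lambda\in\mathbb R$ $$v_X(\lambda)=-v_X(-\lambda).$$ In particular $v_X(0)=0$ and, if $n$ is even and $v_X$ has an $n$-th derivative at $0$, then this derivative is $0$. Moreover, for every $\lambda\ge0$: - if $\mathbb E[\bar S(\lambda)]<\infty$, then $v_X(\lambda)=1/\mathbb E[\bar S(\lambda)]>0$; - if $\mathbb E[\bar S(\lambda)]=\infty$, then $v_X(\lambda)=0$. -/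

import Mathlib

open MeasureTheory ProbabilityTheory Filter Topology
open scoped ENNReal

namespace RWRE

noncomputable section

/-- The space of environments `Ω = (0,1)^ℤ` (with the product σ-algebra). The coordinate `ω x` is
the probability `ω_x^+` to jump from `x` to `x + 1`. -/
abbrev Env : Type := ℤ → Set.Ioo (0 : ℝ) 1

/-- `ω_x^+(lam)`, the biased probability to jump from `x` to `x + 1`. -/
def omegaPlus (ω : Env) (lam : ℝ) (x : ℤ) : ℝ :=
  (ω x : ℝ) * Real.exp lam /
    ((1 - (ω x : ℝ)) * Real.exp (-lam) + (ω x : ℝ) * Real.exp lam)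

/-- `ω_x^-(lam)`, the biased probability to jump from `x` to `x - 1`. -/
def omegaMinus (ω : Env) (lam : ℝ) (x : ℤ) : ℝ :=
  (1 - (ω x : ℝ)) * Real.exp (-lam) /
    ((1 - (ω x : ℝ)) * Real.exp (-lam) + (ω x : ℝ) * Real.exp lam)

/-- `ρ_x(lam) = ω_x^-(lam) / ω_x^+(lam)`. -/
def rho (ω : Env) (lam : ℝ) (x : ℤ) : ℝ := omegaMinus ω lam x / omegaPlus ω lam x

lemma denom_pos (ω : Env) (lam : ℝ) (x : ℤ) :
    0 < (1 - (ω x : ℝ)) * Real.exp (-lam) + (ω x : ℝ) * Real.exp lam := by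
  have h0 : 0 < (ω x : ℝ) := (ω x).2.1
  have h1 : 0 < 1 - (ω x : ℝ) := sub_pos.2 (ω x).2.2
  positivity

lemma omegaPlus_pos (ω : Env) (lam : ℝ) (x : ℤ) : 0 < omegaPlus ω lam x :=
  div_pos (mul_pos (ω x).2.1 (Real.exp_pos _)) (denom_pos ω lam x)

lemma omegaMinus_pos (ω : Env) (lam : ℝ) (x : ℤ) : 0 < omegaMinus ω lam x :=
  div_pos (mul_pos (sub_pos.2 (ω x).2.2) (Real.exp_pos _)) (denom_pos ω lam x)

lemma omegaPlus_add_omegaMinus (ω : Env) (lam : ℝ) (x : ℤ) :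
    omegaPlus ω lam x + omegaMinus ω lam x = 1 := by
  have h := (denom_pos ω lam x).ne'
  unfold omegaPlus omegaMinus
  rw [← add_div, add_comm, div_self h]

/-- The law of the position after one step from `x`. -/
def stepLaw (ω : Env) (lam : ℝ) (x : ℤ) : Measure ℤ :=
  ENNReal.ofReal (omegaPlus ω lam x) • Measure.dirac (x + 1) +
    ENNReal.ofReal (omegaMinus ω lam x) • Measure.dirac (x - 1)

instance isProbabilityMeasure_stepLaw (ω : Env) (lam : ℝ) (x : ℤ) :
    IsProbabilityMeasure (stepLaw ω lam x) := by
  constructor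
  simp only [stepLaw, Measure.add_apply, Measure.smul_apply, measure_univ, smul_eq_mul, mul_one]
  rw [← ENNReal.ofReal_add (omegaPlus_pos ω lam x).le (omegaMinus_pos ω lam x).le,
    omegaPlus_add_omegaMinus, ENNReal.ofReal_one]

/-- The one-step transition kernel on `ℤ`. -/
def stepKernel (ω : Env) (lam : ℝ) : Kernel ℤ ℤ :=
  Kernel.ofFunOfCountable (stepLaw ω lam)

instance isMarkovKernel_stepKernel (ω : Env) (lam : ℝ) : IsMarkovKernel (stepKernel ω lam) :=
  ⟨fun x => isProbabilityMeasure_stepLaw ω lam x⟩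

/-- The conditional law of `X_{n+1}` given `(X_0, …, X_n)`: it is the step law at `X_n`. -/
def histKernel (ω : Env) (lam : ℝ) (n : ℕ) : Kernel ((i : Finset.Iic n) → ℤ) ℤ :=
  (stepKernel ω lam).comap (fun h => h ⟨n, Finset.mem_Iic.2 le_rfl⟩) (measurable_pi_apply _)

instance isMarkovKernel_histKernel (ω : Env) (lam : ℝ) (n : ℕ) :
    IsMarkovKernel (histKernel ω lam n) := by
  unfold histKernel
  infer_instance

/-- The quenched law `P_0^{ω,lam}` on the path space `ℤ^ℕ` of the walk started at the origin. -/
def walkLaw (ω : Env) (lam : ℝ) : Measure (ℕ → ℤ) :=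
  Kernel.trajMeasure (X := fun _ => ℤ) (Measure.dirac (0 : ℤ)) (histKernel ω lam)

instance isProbabilityMeasure_walkLaw (ω : Env) (lam : ℝ) :
    IsProbabilityMeasure (walkLaw ω lam) := by
  unfold walkLaw
  infer_instance

/-- The shift `(ω_x)_x ↦ (ω_{x+1})_x` of environments. -/
def shift (ω : Env) : Env := fun x => ω (x + 1)

/-- The reflection `(ω_x^+)_x ↦ (ω_{-x}^-)_x` of environments. -/
def reflect (ω : Env) : Env := fun x =>
  ⟨1 - (ω (-x) : ℝ), sub_pos.2 (ω (-x)).2.2, sub_lt_self 1 (ω (-x)).2.1⟩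

/-- The law `P` of the environment is stationary and ergodic with respect to shifts, and
`E[log ρ_0]` is well defined in `[-∞, +∞]`, i.e. the positive part or the negative part of
`log ρ_0` has finite expectation. -/
structure MainAssumption (P : Measure Env) : Prop where
  ergodic : Ergodic shift P
  log_rho : (∫⁻ ω, ENNReal.ofReal (Real.log (rho ω 0 0)) ∂P ≠ ∞) ∨
    (∫⁻ ω, ENNReal.ofReal (-Real.log (rho ω 0 0)) ∂P ≠ ∞)

/-- The law `P` of the environment is invariant under reflection. -/
def ReflectionInvariant (P : Measure Env) : Prop := MeasurePreserving reflect P P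

/-- `X_n / n → v` almost surely with respect to `P ⊗ P_0^{ω,lam}`. -/
def IsVelocity (P : Measure Env) (lam v : ℝ) : Prop :=
  ∀ᵐ ω ∂P, ∀ᵐ X ∂(walkLaw ω lam), Tendsto (fun n : ℕ => (X n : ℝ) / (n : ℝ)) atTop (𝓝 v)

/-- The asymptotic velocity is unique. -/
lemma IsVelocity.unique {P : Measure Env} [IsProbabilityMeasure P] {lam v w : ℝ}
    (hv : IsVelocity P lam v) (hw : IsVelocity P lam w) : v = w := by
  obtain ⟨ω, h1, h2⟩ := (hv.and hw).exists
  obtain ⟨X, h3, h4⟩ := (h1.and h2).exists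
  exact tendsto_nhds_unique h3 h4

/-- The asymptotic velocity `v_X(lam)`: the constant `v` such that `X_n / n → v` almost surely
(an unspecified real number if there were no such constant). -/
def vX (P : Measure Env) (lam : ℝ) : ℝ := Classical.epsilon (IsVelocity P lam)

/-- `S̄(lam) = 1 / ω_0^+(lam) + ∑_{i ≥ 1} (1 / ω_{-i}^+(lam)) ∏_{j = 0}^{i-1} ρ_{-j}(lam)`,
with values in `[0, ∞]`. -/
def Sbar (ω : Env) (lam : ℝ) : ℝ≥0∞ :=
  ENNReal.ofReal (1 / omegaPlus ω lam 0) +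
    ∑' k : ℕ, ENNReal.ofReal (1 / omegaPlus ω lam (-((k : ℤ) + 1)) *
      ∏ j ∈ Finset.range (k + 1), rho ω lam (-(j : ℤ)))

/-- `E[S̄(lam)]`, with values in `[0, ∞]`. -/
def meanSbar (P : Measure Env) (lam : ℝ) : ℝ≥0∞ := ∫⁻ ω, Sbar ω lam ∂P

/-- `HasNthDerivAt n f x d`: the function `f` has an `n`-th derivative at `x`, equal to `d`. For
`n + 1` this means that the `n`-th derivative exists in a neighbourhood of `x` and is
differentiable at `x` with derivative `d`. -/
def HasNthDerivAt : ℕ → (ℝ → ℝ) → ℝ → ℝ → Prop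
  | 0, f, x, d => f x = d
  | n + 1, f, x, d => ∃ g : ℝ → ℝ, (∀ᶠ y in 𝓝 x, HasNthDerivAt n f y (g y)) ∧ HasDerivAt g d x

end

end RWRE

/-! Upper bound. The translates S_x of S̄ solve S_x = 1/ω_x^+ + ρ_x S_{x-1}. Formally, a function h
with increments h(x+1) - h(x) = S_x therefore has drift one along the walk, so h(X_n) grows like n,
while h(m)/m tends to E[S̄] by ergodicity. Hence limsup X_n/n ≤ 1/E[S̄], read as 0 if the mean is
infinite. Truncating S (`truncS`) keeps the drift at most one and bounds the increments, so
exponential moments and Borel–Cantelli suffice (`ae_eventually_walk_le`). This works for every λ.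

Lower bound, finite mean. The environment viewed from the particle has an invariant law with
P-density proportional to (1 + ρ_0)(1 + ∑ ρ_1⋯ρ_i), which has integral E[S̄]; under it the first
step has mean 1/E[S̄]. Ergodicity of this process is not needed: for a measure-preserving map, if
the limsup of the Birkhoff averages is a.s. at most the space average, then the liminf cannot be
smaller on a set of positive measure (`eventually_le_birkhoffSum_of_upper`). The upper bound
supplies that hypothesis, and positivity of the density carries the result back to P.

Infinite mean, λ ≥ 0. By reflection invariance a product Y of consecutive ρ_x has the law of 1/Y, so
E[Y] ≥ 1 and E[S̄(-λ)] = ∞ (`meanSbar_neg_eq_top`). The upper bound gives limsup ≤ 0 under both λ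
and -λ, and reflecting the latter gives liminf ≥ 0 under λ. Oddness, and with it existence for λ <
0, comes from reflecting the walk (`IsVelocity.neg`). -/

namespace RWRE

/-! ### Maximal ergodic theorem and one-sided Birkhoff theorems. -/

section Ergodic

set_option linter.unusedSectionVars false

variable {α : Type*} [MeasurableSpace α]

lemma measurable_birkhoffSum {T : α → α} (hT : Measurable T) {f : α → ℝ} (hf : Measurable f)
    (n : ℕ) : Measurable (birkhoffSum T f n) := by
  unfold birkhoffSum
  exact Finset.measurable_sum _ fun k _ => hf.comp (hT.iterate k)

lemma integrable_birkhoffSum {μ : Measure α} {T : α → α} (hT : MeasurePreserving T μ μ)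
    {f : α → ℝ} (hf : Integrable f μ) (n : ℕ) : Integrable (birkhoffSum T f n) μ := by
  unfold birkhoffSum
  exact integrable_finsetSum _ fun k _ => (hT.iterate k).integrable_comp_of_integrable hf

/-- The running maximum `max_{k ≤ n} S_k f` of the Birkhoff sums. -/
noncomputable def birkhoffMax (T : α → α) (f : α → ℝ) : ℕ → α → ℝ
  | 0, _ => 0
  | n + 1, x => max (birkhoffMax T f n x) (birkhoffSum T f (n + 1) x)

lemma birkhoffMax_nonneg (T : α → α) (f : α → ℝ) (n : ℕ) (x : α) : 0 ≤ birkhoffMax T f n x := by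
  induction n with
  | zero => exact le_rfl
  | succ n ih => exact ih.trans (le_max_left _ _)

lemma birkhoffSum_le_birkhoffMax (T : α → α) (f : α → ℝ) {k n : ℕ} (h : k ≤ n) (x : α) :
    birkhoffSum T f k x ≤ birkhoffMax T f n x := by
  induction n with
  | zero => obtain rfl : k = 0 := by omega
            simp [birkhoffMax]
  | succ n ih =>
    rcases Nat.lt_or_eq_of_le h with h | rfl
    · exact (ih (by omega)).trans (le_max_left _ _)
    · exact le_max_right _ _

/-- Each nonempty sum S_{m+1}(x) equals f(x) + S_m(Tx). This recursion drives Garsia's proof of the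
maximal theorem. -/
lemma birkhoffMax_le (T : α → α) (f : α → ℝ) (n : ℕ) (x : α) :
    birkhoffMax T f n x ≤ max 0 (f x + birkhoffMax T f n (T x)) := by
  suffices H : ∀ m ≤ n, birkhoffMax T f m x ≤ max 0 (f x + birkhoffMax T f n (T x)) from H n le_rfl
  intro m hm
  induction m with
  | zero => exact le_max_left _ _
  | succ m ih =>
    refine max_le (ih (by omega)) (le_max_of_le_right ?_)
    rw [birkhoffSum_succ']
    gcongr
    exact birkhoffSum_le_birkhoffMax T f (by omega) _

lemma birkhoffMax_integrable {μ : Measure α} {T : α → α}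
    (hT : MeasurePreserving T μ μ) {f : α → ℝ} (hf : Integrable f μ) (n : ℕ) :
    Integrable (birkhoffMax T f n) μ := by
  induction n with
  | zero => exact integrable_zero _ _ _
  | succ n ih => exact ih.sup (integrable_birkhoffSum hT hf (n + 1))

lemma measurable_birkhoffMax {T : α → α} (hT : Measurable T) {f : α → ℝ} (hf : Measurable f)
    (n : ℕ) : Measurable (birkhoffMax T f n) := by
  induction n with
  | zero => exact measurable_const
  | succ n ih => exact ih.max (measurable_birkhoffSum hT hf (n + 1))

/-- The maximal ergodic theorem on an invariant set. -/
theorem setIntegral_nonneg_of_exists_birkhoffSum_pos {μ : Measure α} {T : α → α}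
    (hT : MeasurePreserving T μ μ) {f : α → ℝ} (hfm : Measurable f) (hf : Integrable f μ)
    {A : Set α} (hA : MeasurableSet A) (hTA : T ⁻¹' A = A)
    (h : ∀ᵐ x ∂μ, x ∈ A → ∃ n, 0 < birkhoffSum T f n x) : 0 ≤ ∫ x in A, f x ∂μ := by
  have hTA' : MeasurePreserving T (μ.restrict A) (μ.restrict A) := by
    have := hT.restrict_preimage hA
    rwa [hTA] at this
  have hmp (n : ℕ) : MeasurableSet {x | 0 < birkhoffMax T f n x} :=
    measurableSet_lt measurable_const (measurable_birkhoffMax hT.measurable hfm n)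
  have key (n : ℕ) : 0 ≤ ∫ x in A, {x | 0 < birkhoffMax T f n x}.indicator f x ∂μ := by
    have hI := birkhoffMax_integrable hT hf n
    have hI1 : Integrable (birkhoffMax T f n) (μ.restrict A) := hI.integrableOn
    have hI2 : Integrable (fun x => birkhoffMax T f n (T x)) (μ.restrict A) :=
      hTA'.integrable_comp_of_integrable hI1
    have e : ∫ x in A, birkhoffMax T f n (T x) ∂μ = ∫ x in A, birkhoffMax T f n x ∂μ := by
      have := integral_map (μ := μ.restrict A) hTA'.measurable.aemeasurable
        (f := birkhoffMax T f n)
        (measurable_birkhoffMax hT.measurable hfm n).aestronglyMeasurable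
      rw [hTA'.map_eq] at this
      exact this.symm
    have h1 : ∫ x in A, (birkhoffMax T f n x - birkhoffMax T f n (T x)) ∂μ = 0 := by
      rw [integral_sub hI1 hI2, e, sub_self]
    refine h1.symm.trans_le ?_
    -- Where the maximum M is positive, the recursion gives M - M∘T ≤ f; elsewhere M = 0 ≤ M∘T.
    refine integral_mono (hI1.sub hI2) (hf.integrableOn.indicator (hmp n)) fun x => ?_
    by_cases hx : 0 < birkhoffMax T f n x
    · have := birkhoffMax_le T f n x
      rw [Set.indicator_of_mem (by exact hx)]
      rcases le_max_iff.1 this with h' | h' <;> simp only <;> linarith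
    · rw [Set.indicator_of_notMem (by exact hx)]
      have := birkhoffMax_nonneg T f n (T x)
      simp only
      linarith
  -- Almost every point of A eventually lies in {M_n > 0}, so the indicators disappear in the limit.
  refine ge_of_tendsto' (tendsto_integral_of_dominated_convergence (fun x => |f x|)
    (fun n => (hfm.indicator (hmp n)).aestronglyMeasurable) hf.integrableOn.abs
    (fun n => ae_of_all _ fun x => ?_) ?_) key
  · by_cases hx : 0 < birkhoffMax T f n x <;> simp [Set.indicator, hx]
  · rw [ae_restrict_iff' hA]
    filter_upwards [h] with x hx hxA
    obtain ⟨n, hn⟩ := hx hxA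
    refine tendsto_const_nhds.congr' ?_
    filter_upwards [eventually_ge_atTop n] with m hm
    rw [Set.indicator_of_mem]
    exact hn.trans_le (birkhoffSum_le_birkhoffMax T f hm x)

/-- The set of points where the lower limit of the Birkhoff averages is smaller than `c`. -/
def liminfLT (T : α → α) (f : α → ℝ) (c : ℝ) : Set α :=
  {x | ∃ k : ℕ, ∃ᶠ n : ℕ in atTop, birkhoffSum T f n x < (c - 1 / (k + 1 : ℝ)) * n}

lemma measurableSet_liminfLT {T : α → α} (hT : Measurable T) {f : α → ℝ} (hf : Measurable f)
    (c : ℝ) : MeasurableSet (liminfLT T f c) := by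
  have : liminfLT T f c = ⋃ k : ℕ, ⋂ N : ℕ, ⋃ n : ℕ, ⋃ _ : N ≤ n,
      {x | birkhoffSum T f n x < (c - 1 / (k + 1 : ℝ)) * n} := by
    ext x
    simp [liminfLT, frequently_atTop]
  rw [this]
  exact .iUnion fun k => .iInter fun N => .iUnion fun n => .iUnion fun _ =>
    measurableSet_lt (measurable_birkhoffSum hT hf n) measurable_const

/-- Gives exact, not just a.e., invariance of `liminfLT`. Half of the gap 1/(k+1) below c is kept,
which is the index 2k+1; the other half, multiplied by a large time, absorbs the bounded errors from
d, N and M. -/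
lemma exists_frequently_lt_of_shift {a b : ℕ → ℝ} {c d : ℝ} {N M : ℕ}
    (hab : ∀ n, a (n + N) ≤ b (n + M) + d)
    (h : ∃ k : ℕ, ∃ᶠ n : ℕ in atTop, b n < (c - 1 / (k + 1 : ℝ)) * n) :
    ∃ k : ℕ, ∃ᶠ n : ℕ in atTop, a n < (c - 1 / (k + 1 : ℝ)) * n := by
  obtain ⟨k, hk⟩ := h
  refine ⟨2 * k + 1, ?_⟩
  obtain ⟨R, hR⟩ := exists_nat_gt
    ((2 * (k + 1 : ℝ)) * ((c - 1 / (k + 1 : ℝ)) * M + d - (c - 1 / (2 * (k + 1 : ℝ))) * N))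
  rw [frequently_atTop] at hk ⊢
  intro L
  obtain ⟨n, hn, hn'⟩ := hk (L + R + M)
  obtain ⟨m, rfl⟩ := Nat.exists_eq_add_of_le' (show M ≤ n by omega)
  refine ⟨m + N, by omega, (hab m).trans_lt ?_⟩
  have hm : (R : ℝ) ≤ m := by exact_mod_cast (show R ≤ m by omega)
  have hk0 : (0 : ℝ) < k + 1 := by positivity
  have e : (1 : ℝ) / (k + 1) = 2 * (1 / (2 * (k + 1))) := by field_simp
  have hR' := hR.trans_le hm
  rw [e] at hR' hn'
  set s : ℝ := 1 / (2 * (k + 1 : ℝ)) with hs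
  have hs0 : 0 < s := by positivity
  have e2 : s * (2 * (k + 1 : ℝ)) = 1 := by rw [hs]; field_simp
  have h3 := mul_lt_mul_of_pos_left hR' hs0
  rw [← mul_assoc, e2, one_mul] at h3
  push_cast at hn' ⊢
  have e3 : (1 : ℝ) / (2 * k + 1 + 1) = s := by rw [hs]; congr 1; ring
  rw [e3]
  nlinarith

lemma preimage_liminfLT (T : α → α) (f : α → ℝ) (c : ℝ) :
    T ⁻¹' liminfLT T f c = liminfLT T f c := by
  ext x
  constructor
  · refine exists_frequently_lt_of_shift (N := 1) (M := 0) (d := f x) fun n => ?_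
    rw [birkhoffSum_succ']
    simp [add_comm]
  · refine exists_frequently_lt_of_shift (N := 0) (M := 1) (d := - f x) fun n => ?_
    rw [birkhoffSum_succ']
    simp

lemma birkhoffSum_const_sub (T : α → α) (f : α → ℝ) (c : ℝ) (n : ℕ) (x : α) :
    birkhoffSum T (fun y => c - f y) n x = c * n - birkhoffSum T f n x := by
  simp [birkhoffSum, mul_comm]

lemma setIntegral_liminfLT_le {μ : Measure α} [IsProbabilityMeasure μ] {T : α → α}
    (hT : MeasurePreserving T μ μ) {f : α → ℝ} (hfm : Measurable f) (hf : Integrable f μ)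
    (c : ℝ) : ∫ x in liminfLT T f c, f x ∂μ ≤ c * μ.real (liminfLT T f c) := by
  have h := setIntegral_nonneg_of_exists_birkhoffSum_pos hT (f := fun y => c - f y)
    (measurable_const.sub hfm) ((integrable_const c).sub hf)
    (measurableSet_liminfLT hT.measurable hfm c) (preimage_liminfLT T f c)
    (ae_of_all _ fun x hx => by
      obtain ⟨k, hk⟩ := hx
      obtain ⟨n, hn⟩ := hk.exists
      refine ⟨n, ?_⟩
      rw [birkhoffSum_const_sub]
      have : 0 ≤ 1 / (k + 1 : ℝ) * n := by positivity
      linarith)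
  rw [integral_sub (integrable_const c) hf.integrableOn] at h
  simp at h
  linarith

lemma eventually_le_of_notMem_liminfLT {T : α → α} {f : α → ℝ} {c c' : ℝ} (hc : c < c') {x : α}
    (hx : x ∉ liminfLT T f c') : ∀ᶠ n : ℕ in atTop, c * n ≤ birkhoffSum T f n x := by
  simp only [liminfLT, Set.mem_ofPred_eq, not_exists, not_frequently, not_lt] at hx
  obtain ⟨k, hk⟩ := exists_nat_one_div_lt (sub_pos.2 hc)
  filter_upwards [hx k] with n hn
  refine le_trans ?_ hn
  gcongr
  linarith

/-- The lower half of Birkhoff's theorem for ergodic maps. -/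
theorem Ergodic.eventually_le_birkhoffSum {μ : Measure α} [IsProbabilityMeasure μ] {T : α → α}
    (hT : Ergodic T μ) {f : α → ℝ} (hfm : Measurable f) (hf : Integrable f μ) {c : ℝ}
    (hc : c < ∫ x, f x ∂μ) : ∀ᵐ x ∂μ, ∀ᶠ n : ℕ in atTop, c * n ≤ birkhoffSum T f n x := by
  obtain ⟨c', hc1, hc2⟩ := exists_between hc
  have hm := measurableSet_liminfLT hT.measurable hfm c'
  have : ∀ᵐ x ∂μ, x ∉ liminfLT T f c' := by
    -- The set is invariant, hence null or full; if full, the maximal theorem would give ∫ f ≤ c' <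
    -- ∫ f.
    rcases hT.toPreErgodic.ae_empty_or_univ hm (preimage_liminfLT T f c') with h | h
    · exact (measure_eq_zero_iff_ae_notMem).1 (ae_eq_empty.1 h)
    · exfalso
      have h1 := setIntegral_liminfLT_le hT.toMeasurePreserving hfm hf c'
      rw [setIntegral_congr_set h, setIntegral_univ, measureReal_congr h] at h1
      simp at h1
      linarith
  filter_upwards [this] with x hx using eventually_le_of_notMem_liminfLT hc1 hx

/-- If the upper limit of the Birkhoff averages does not exceed the space average, then neither is
the lower limit smaller than it. -/
theorem eventually_le_birkhoffSum_of_upper {μ : Measure α} [IsProbabilityMeasure μ] {T : α → α}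
    (hT : MeasurePreserving T μ μ) {f : α → ℝ} (hfm : Measurable f) (hf : Integrable f μ)
    (hup : ∀ d > ∫ x, f x ∂μ, ∀ᵐ x ∂μ, ∀ᶠ n : ℕ in atTop, birkhoffSum T f n x ≤ d * n) {c : ℝ}
    (hc : c < ∫ x, f x ∂μ) : ∀ᵐ x ∂μ, ∀ᶠ n : ℕ in atTop, c * n ≤ birkhoffSum T f n x := by
  obtain ⟨c', hc1, hc2⟩ := exists_between hc
  set v := ∫ x, f x ∂μ with hv
  set A := liminfLT T f c' with hA
  have hm : MeasurableSet A := measurableSet_liminfLT hT.measurable hfm c'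
  have h1 : ∫ x in A, f x ∂μ ≤ c' * μ.real A := setIntegral_liminfLT_le hT hfm hf c'
  -- The upper bound makes every Birkhoff sum of d - f eventually positive, so the maximal theorem
  -- applies on the invariant complement of A.
  have h2 : ∀ d > v, ∫ x in Aᶜ, f x ∂μ ≤ d * μ.real Aᶜ := by
    intro d hd
    obtain ⟨d', hd1, hd2⟩ := exists_between hd
    have h := setIntegral_nonneg_of_exists_birkhoffSum_pos hT (f := fun y => d - f y)
      (measurable_const.sub hfm) ((integrable_const d).sub hf) hm.compl
      (by rw [Set.preimage_compl, preimage_liminfLT]) (by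
        filter_upwards [hup d' hd1] with x hx _
        obtain ⟨n, hn, hn'⟩ := (hx.and (eventually_gt_atTop 0)).exists
        refine ⟨n, ?_⟩
        rw [birkhoffSum_const_sub]
        have : (0 : ℝ) < n := by exact_mod_cast hn'
        nlinarith)
    rw [integral_sub (integrable_const d) hf.integrableOn] at h
    simp at h
    linarith
  have h3 : ∫ x in Aᶜ, f x ∂μ ≤ v * μ.real Aᶜ := by
    have ht : Tendsto (fun d => d * μ.real Aᶜ) (𝓝[>] v) (𝓝 (v * μ.real Aᶜ)) :=
      ((continuous_id.mul continuous_const).tendsto v).mono_left nhdsWithin_le_nhds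
    exact ge_of_tendsto ht (eventually_mem_nhdsWithin.mono h2)
  have h4 : ∫ x in A, f x ∂μ + ∫ x in Aᶜ, f x ∂μ = v := integral_add_compl hm hf
  have h5 : μ.real A + μ.real Aᶜ = 1 := by
    rw [measureReal_add_measureReal_compl hm]; simp
  -- Adding `h1` and `h3` gives v ≤ c' μ(A) + v (1 - μ(A)) with c' < v.
  have h6 : μ.real A = 0 := by
    have := measureReal_nonneg (μ := μ) (s := A)
    by_contra h
    have : 0 < μ.real A := lt_of_le_of_ne this (Ne.symm h)
    rw [eq_sub_of_add_eq' h5] at h3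
    nlinarith [mul_pos this (sub_pos.2 hc2)]
  have : ∀ᵐ x ∂μ, x ∉ A :=
    (measure_eq_zero_iff_ae_notMem).1 ((measureReal_eq_zero_iff).1 h6)
  filter_upwards [this] with x hx using eventually_le_of_notMem_liminfLT hc1 hx

end Ergodic

/-! ### The quenched law: cylinders, Markov property, reflection. -/

section Paths

/-- The set of paths that agree with `x` up to time `n`. -/
def cyl (n : ℕ) (x : ℕ → ℤ) : Set (ℕ → ℤ) := {X | ∀ i ≤ n, X i = x i}

lemma cyl_zero (x : ℕ → ℤ) : cyl 0 x = {X | X 0 = x 0} := by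
  ext X; simp [cyl]

lemma cyl_succ (n : ℕ) (x : ℕ → ℤ) : cyl (n + 1) x = cyl n x ∩ {X | X (n + 1) = x (n + 1)} := by
  ext X
  simp only [cyl, Set.mem_ofPred_eq, Set.mem_inter_iff]
  exact ⟨fun h => ⟨fun i hi => h i (by omega), h _ le_rfl⟩, fun h i hi => by
    rcases Nat.lt_or_eq_of_le hi with h' | rfl
    exacts [h.1 i (by omega), h.2]⟩

lemma measurableSet_cyl (n : ℕ) (x : ℕ → ℤ) : MeasurableSet (cyl n x) := by
  induction n with
  | zero => rw [cyl_zero]; exact measurable_pi_apply 0 (measurableSet_singleton _)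
  | succ n ih =>
    rw [cyl_succ]
    exact ih.inter (measurable_pi_apply (n + 1) (measurableSet_singleton _))

/-- The π-system of cylinders on path space. -/
def cylSets : Set (Set (ℕ → ℤ)) := {s | s = ∅ ∨ ∃ n x, s = cyl n x}

lemma isPiSystem_cylSets : IsPiSystem cylSets := by
  have key : ∀ {n m : ℕ} (x y : ℕ → ℤ), n ≤ m → (cyl n x ∩ cyl m y).Nonempty →
      cyl n x ∩ cyl m y = cyl m y := by
    rintro n m x y hnm ⟨Z, hZ1, hZ2⟩
    refine Set.inter_eq_right.2 fun X hX i hi => ?_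
    rw [hX i (hi.trans hnm), ← hZ2 i (hi.trans hnm), hZ1 i hi]
  rintro s (rfl | ⟨n, x, rfl⟩) t (rfl | ⟨m, y, rfl⟩) hst
  · simp at hst
  · simp at hst
  · simp at hst
  · rcases le_total n m with h | h
    · exact Or.inr ⟨m, y, key x y h hst⟩
    · rw [Set.inter_comm] at hst ⊢
      exact Or.inr ⟨n, x, key y x h hst⟩

lemma generateFrom_cylSets :
    (inferInstance : MeasurableSpace (ℕ → ℤ)) = MeasurableSpace.generateFrom cylSets := by
  refine le_antisymm ?_ (MeasurableSpace.generateFrom_le ?_)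
  · refine iSup_le fun i => ?_
    rw [← measurable_iff_comap_le]
    refine @measurable_to_countable' _ _ _ _ (MeasurableSpace.generateFrom cylSets) _ fun a => ?_
    -- A countable union over histories up to time i. The value 0 after time i is immaterial, since
    -- `cyl i` does not see it.
    have : (fun X : ℕ → ℤ => X i) ⁻¹' {a} = ⋃ f : Fin (i + 1) → ℤ, ⋃ _ : f (Fin.last i) = a,
        cyl i (fun k => if h : k < i + 1 then f ⟨k, h⟩ else 0) := by
      ext X
      simp only [Set.mem_preimage, Set.mem_singleton_iff, Set.mem_iUnion, exists_prop]
      constructor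
      · intro h
        exact ⟨fun k => X k, h, fun k hk => by simp [Nat.lt_succ_of_le hk]⟩
      · rintro ⟨f, hf, h⟩
        rw [h i le_rfl]
        simp only [Nat.lt_add_one, dite_true]
        exact hf
    rw [this]
    exact .iUnion fun f => .iUnion fun _ =>
      MeasurableSpace.measurableSet_generateFrom (Or.inr ⟨_, _, rfl⟩)
  · rintro s (rfl | ⟨n, x, rfl⟩)
    exacts [.empty, measurableSet_cyl n x]

lemma ext_of_cyl {μ ν : Measure (ℕ → ℤ)} [IsProbabilityMeasure μ] [IsProbabilityMeasure ν]
    (h : ∀ n x, μ (cyl n x) = ν (cyl n x)) : μ = ν := by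
  refine ext_of_generate_finite cylSets generateFrom_cylSets isPiSystem_cylSets ?_ (by simp)
  rintro s (rfl | ⟨n, x, rfl⟩)
  exacts [by simp, h n x]

lemma walkLaw_cyl_zero (ω : Env) (lam : ℝ) (x : ℕ → ℤ) :
    walkLaw ω lam (cyl 0 x) = if x 0 = 0 then 1 else 0 := by
  have h : (walkLaw ω lam).map (Preorder.frestrictLe 0) =
      (Measure.dirac (0 : ℤ)).map (MeasurableEquiv.piUnique
        (fun i : Finset.Iic 0 => ℤ)).symm := by
    unfold walkLaw Kernel.trajMeasure
    rw [Measure.map_comp _ _ (by fun_prop), Kernel.traj_map_frestrictLe, Kernel.partialTraj_self]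
    exact Measure.id_comp
  have e : cyl 0 x = Preorder.frestrictLe (π := fun _ : ℕ => ℤ) 0 ⁻¹'
      {y | y ⟨0, by simp⟩ = x 0} := by
    rw [cyl_zero]; rfl
  have hm : MeasurableSet {y : (i : Finset.Iic 0) → ℤ | y ⟨0, by simp⟩ = x 0} :=
    measurable_pi_apply (X := fun _ : Finset.Iic 0 => ℤ) ⟨0, by simp⟩ (measurableSet_singleton (x 0))
  rw [e, ← Measure.map_apply (by fun_prop) hm, h, Measure.map_apply (by fun_prop) hm,
    Measure.dirac_apply' _ (by measurability)]
  simp [Set.indicator, MeasurableEquiv.piUnique, eq_comm]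

lemma walkLaw_cyl_succ (ω : Env) (lam : ℝ) (n : ℕ) (x : ℕ → ℤ) :
    walkLaw ω lam (cyl (n + 1) x) =
      walkLaw ω lam (cyl n x) * stepLaw ω lam (x n) {x (n + 1)} := by
  have h := Kernel.map_frestrictLe_trajMeasure_compProd_eq_map_trajMeasure (X := fun _ => ℤ)
    (μ₀ := Measure.dirac (0 : ℤ)) (κ := histKernel ω lam) (a := n)
  change (walkLaw ω lam).map _ ⊗ₘ _ = (walkLaw ω lam).map _ at h
  set A : Set ((i : Finset.Iic n) → ℤ) := {fun i : Finset.Iic n => x i} with hA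
  have hAm : MeasurableSet A := measurableSet_singleton _
  have e1 : cyl n x = Preorder.frestrictLe (π := fun _ : ℕ => ℤ) n ⁻¹' A := by
    ext X
    simp [cyl, hA, funext_iff]
  have e2 : cyl (n + 1) x = (fun X : ℕ → ℤ => (Preorder.frestrictLe (π := fun _ : ℕ => ℤ) n X,
      X (n + 1))) ⁻¹' (A ×ˢ {x (n + 1)}) := by
    rw [cyl_succ, e1]
    rfl
  rw [e2, ← Measure.map_apply (by fun_prop) (hAm.prod (measurableSet_singleton _)), ← h,
    Measure.compProd_apply_prod hAm (measurableSet_singleton _), hA, lintegral_singleton,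
    ← hA, Measure.map_apply (by fun_prop) hAm, ← e1, mul_comm]
  rfl

/-- Initial point and one-step transitions determine the law; both the Markov decomposition and the
reflection identity are proved by checking these. -/
lemma eq_walkLaw {ω : Env} {lam : ℝ} {μ : Measure (ℕ → ℤ)} [IsProbabilityMeasure μ]
    (h0 : ∀ x, μ (cyl 0 x) = if x 0 = 0 then 1 else 0)
    (h1 : ∀ n x, μ (cyl (n + 1) x) = μ (cyl n x) * stepLaw ω lam (x n) {x (n + 1)}) :
    μ = walkLaw ω lam := by
  refine ext_of_cyl fun n x => ?_
  induction n with
  | zero => rw [h0, walkLaw_cyl_zero]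
  | succ n ih => rw [h1, walkLaw_cyl_succ, ih]

lemma measurable_coord (x : ℤ) : Measurable fun ω : Env => (ω x : ℝ) :=
  measurable_subtype_coe.comp (measurable_pi_apply x)

@[fun_prop]
lemma measurable_omegaPlus (lam : ℝ) (x : ℤ) : Measurable fun ω => omegaPlus ω lam x := by
  have := measurable_coord x
  unfold omegaPlus
  fun_prop

@[fun_prop]
lemma measurable_omegaMinus (lam : ℝ) (x : ℤ) : Measurable fun ω => omegaMinus ω lam x := by
  have := measurable_coord x
  unfold omegaMinus
  fun_prop

@[fun_prop]
lemma measurable_rho (lam : ℝ) (x : ℤ) : Measurable fun ω => rho ω lam x := by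
  unfold rho
  fun_prop

lemma stepLaw_singleton (ω : Env) (lam : ℝ) (x y : ℤ) : stepLaw ω lam x {y} =
    (if y = x + 1 then ENNReal.ofReal (omegaPlus ω lam x) else 0) +
      if y = x - 1 then ENNReal.ofReal (omegaMinus ω lam x) else 0 := by
  simp [stepLaw, Set.indicator, eq_comm]

lemma measurable_walkLaw (lam : ℝ) : Measurable fun ω => walkLaw ω lam := by
  refine Measurable.measure_of_isPiSystem_of_isProbabilityMeasure generateFrom_cylSets
    isPiSystem_cylSets ?_
  rintro s (rfl | ⟨n, x, rfl⟩)
  · simp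
  · induction n with
    | zero => simp [walkLaw_cyl_zero]
    | succ n ih =>
      simp_rw [walkLaw_cyl_succ, stepLaw_singleton]
      refine ih.mul (.add ?_ ?_) <;> split_ifs <;> fun_prop

/-- The quenched law of the walk as a kernel from environments to paths. -/
noncomputable def walkKernel (lam : ℝ) : Kernel Env (ℕ → ℤ) := ⟨_, measurable_walkLaw lam⟩

lemma walkKernel_apply (lam : ℝ) (ω : Env) : walkKernel lam ω = walkLaw ω lam := rfl

instance (lam : ℝ) : IsMarkovKernel (walkKernel lam) := ⟨fun ω => isProbabilityMeasure_walkLaw ω lam⟩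

lemma ae_walkLaw_zero (ω : Env) (lam : ℝ) : ∀ᵐ X ∂walkLaw ω lam, X 0 = 0 := by
  have := walkLaw_cyl_zero ω lam 0
  rw [cyl_zero] at this
  simp only [Pi.zero_apply, if_true] at this
  exact mem_ae_iff_prob_eq_one (measurable_pi_apply 0 (measurableSet_singleton _)) |>.2 this

/-- Translation of environments by `k`. -/
def translate (k : ℤ) (ω : Env) : Env := fun x => ω (x + k)

@[simp] lemma omegaPlus_translate (k : ℤ) (ω : Env) (lam : ℝ) (x : ℤ) :
    omegaPlus (translate k ω) lam x = omegaPlus ω lam (x + k) := rfl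

@[simp] lemma omegaMinus_translate (k : ℤ) (ω : Env) (lam : ℝ) (x : ℤ) :
    omegaMinus (translate k ω) lam x = omegaMinus ω lam (x + k) := rfl

@[simp] lemma rho_translate (k : ℤ) (ω : Env) (lam : ℝ) (x : ℤ) :
    rho (translate k ω) lam x = rho ω lam (x + k) := rfl

/-- The path that starts at `0` and continues with `X + s`. -/
def prepend (s : ℤ) (X : ℕ → ℤ) : ℕ → ℤ
  | 0 => 0
  | n + 1 => X n + s

lemma measurable_prepend (s : ℤ) : Measurable (prepend s) := by
  refine measurable_pi_lambda _ fun n => ?_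
  cases n with
  | zero => exact measurable_const
  | succ n => exact (by fun_prop : Measurable fun X : ℕ → ℤ => X n + s)

lemma prepend_preimage_cyl_zero (s : ℤ) (x : ℕ → ℤ) :
    prepend s ⁻¹' cyl 0 x = if x 0 = 0 then Set.univ else ∅ := by
  rw [cyl_zero]
  ext X
  split_ifs with h <;> simp [prepend, h, eq_comm]

lemma prepend_preimage_cyl_succ (s : ℤ) (n : ℕ) (x : ℕ → ℤ) :
    prepend s ⁻¹' cyl (n + 1) x = if x 0 = 0 then cyl n (fun k => x (k + 1) - s) else ∅ := by
  ext X
  split_ifs with h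
  · simp only [cyl, Set.mem_preimage, Set.mem_ofPred_eq]
    constructor
    · intro H i hi
      have := H (i + 1) (by omega)
      simp only [prepend] at this
      omega
    · intro H i hi
      cases i with
      | zero => simp [prepend, h]
      | succ i =>
        have := H i (by omega)
        simp only [prepend]
        omega
  · simp only [Set.mem_preimage, Set.mem_empty_iff_false, iff_false]
    intro H
    exact h (H 0 (by omega)).symm

lemma stepLaw_translate (k : ℤ) (ω : Env) (lam : ℝ) (x y : ℤ) :
    stepLaw (translate k ω) lam (x - k) {y - k} = stepLaw ω lam x {y} := by
  simp only [stepLaw_singleton, omegaPlus_translate, omegaMinus_translate, sub_add_cancel]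
  congr 2 <;> simp only [eq_iff_iff] <;> omega

lemma ofReal_omegaPlus_add (ω : Env) (lam : ℝ) (x : ℤ) :
    ENNReal.ofReal (omegaPlus ω lam x) + ENNReal.ofReal (omegaMinus ω lam x) = 1 := by
  rw [← ENNReal.ofReal_add (omegaPlus_pos ω lam x).le (omegaMinus_pos ω lam x).le,
    omegaPlus_add_omegaMinus, ENNReal.ofReal_one]

/-- The Markov property at time one. -/
theorem walkLaw_eq (ω : Env) (lam : ℝ) : walkLaw ω lam =
    ENNReal.ofReal (omegaPlus ω lam 0) • (walkLaw (translate 1 ω) lam).map (prepend 1) +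
      ENNReal.ofReal (omegaMinus ω lam 0) •
        (walkLaw (translate (-1) ω) lam).map (prepend (-1)) := by
  have hp (k s : ℤ) : IsProbabilityMeasure ((walkLaw (translate k ω) lam).map (prepend s)) :=
    Measure.isProbabilityMeasure_map (measurable_prepend s).aemeasurable
  symm
  set μ := ENNReal.ofReal (omegaPlus ω lam 0) • (walkLaw (translate 1 ω) lam).map (prepend 1) +
      ENNReal.ofReal (omegaMinus ω lam 0) •
        (walkLaw (translate (-1) ω) lam).map (prepend (-1)) with hμ
  have hμ' (n : ℕ) (x : ℕ → ℤ) : μ (cyl n x) = ENNReal.ofReal (omegaPlus ω lam 0) *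
      walkLaw (translate 1 ω) lam (prepend 1 ⁻¹' cyl n x) + ENNReal.ofReal (omegaMinus ω lam 0) *
        walkLaw (translate (-1) ω) lam (prepend (-1) ⁻¹' cyl n x) := by
    simp [hμ, Measure.map_apply (measurable_prepend _) (measurableSet_cyl n x)]
  have : IsProbabilityMeasure μ := ⟨by
    simp only [hμ, Measure.add_apply, Measure.smul_apply, measure_univ, smul_eq_mul, mul_one]
    exact ofReal_omegaPlus_add ω lam 0⟩
  have h0 (x : ℕ → ℤ) : μ (cyl 0 x) = if x 0 = 0 then 1 else 0 := by
    rw [hμ', prepend_preimage_cyl_zero, prepend_preimage_cyl_zero]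
    split_ifs
    · simp [ofReal_omegaPlus_add ω lam 0]
    · simp
  refine eq_walkLaw h0 fun n x => ?_
  cases n with
  | zero =>
    rw [h0, hμ', prepend_preimage_cyl_succ, prepend_preimage_cyl_succ]
    split_ifs with h
    · rw [walkLaw_cyl_zero, walkLaw_cyl_zero, h, stepLaw_singleton]
      simp only [zero_add, sub_eq_zero, sub_neg_eq_add, add_eq_zero_iff_eq_neg, zero_sub]
      simp
    · simp
  | succ n =>
    rw [hμ', hμ', prepend_preimage_cyl_succ, prepend_preimage_cyl_succ, prepend_preimage_cyl_succ,
      prepend_preimage_cyl_succ]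
    split_ifs with h
    · rw [walkLaw_cyl_succ, walkLaw_cyl_succ, stepLaw_translate, stepLaw_translate]
      ring
    · simp

lemma lintegral_walkLaw (ω : Env) (lam : ℝ) {F : (ℕ → ℤ) → ℝ≥0∞} (hF : Measurable F) :
    ∫⁻ X, F X ∂walkLaw ω lam =
      ENNReal.ofReal (omegaPlus ω lam 0) *
        ∫⁻ X, F (prepend 1 X) ∂walkLaw (translate 1 ω) lam +
      ENNReal.ofReal (omegaMinus ω lam 0) *
        ∫⁻ X, F (prepend (-1) X) ∂walkLaw (translate (-1) ω) lam := by
  rw [walkLaw_eq, lintegral_add_measure, lintegral_smul_measure, lintegral_smul_measure,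
    lintegral_map hF (measurable_prepend _), lintegral_map hF (measurable_prepend _)]
  rfl

lemma omegaPlus_reflect (ω : Env) (lam : ℝ) (x : ℤ) :
    omegaPlus (reflect ω) lam x = omegaMinus ω (-lam) (-x) := by
  simp [omegaPlus, omegaMinus, reflect, add_comm]

lemma omegaMinus_reflect (ω : Env) (lam : ℝ) (x : ℤ) :
    omegaMinus (reflect ω) lam x = omegaPlus ω (-lam) (-x) := by
  simp [omegaPlus, omegaMinus, reflect, add_comm]

lemma neg_preimage_cyl (n : ℕ) (x : ℕ → ℤ) :
    (fun X : ℕ → ℤ => -X) ⁻¹' cyl n x = cyl n (-x) := by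
  ext X
  simp [cyl, neg_eq_iff_eq_neg]

theorem walkLaw_reflect (ω : Env) (lam : ℝ) :
    walkLaw (reflect ω) lam = (walkLaw ω (-lam)).map (fun X => -X) := by
  have hm : Measurable fun X : ℕ → ℤ => -X := by fun_prop
  have : IsProbabilityMeasure ((walkLaw ω (-lam)).map (fun X => -X)) :=
    Measure.isProbabilityMeasure_map hm.aemeasurable
  symm
  refine eq_walkLaw (fun x => ?_) fun n x => ?_
  · rw [Measure.map_apply hm (measurableSet_cyl _ _), neg_preimage_cyl, walkLaw_cyl_zero]
    simp
  · rw [Measure.map_apply hm (measurableSet_cyl _ _), Measure.map_apply hm (measurableSet_cyl _ _),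
      neg_preimage_cyl, neg_preimage_cyl, walkLaw_cyl_succ, stepLaw_singleton, stepLaw_singleton,
      omegaPlus_reflect, omegaMinus_reflect, add_comm]
    simp only [Pi.neg_apply]
    congr 3 <;> simp only [eq_iff_iff] <;> omega

end Paths

/-! ### Upper bound on the speed by a function of drift at most one. -/

section UpperBound

lemma measurable_translate (k : ℤ) : Measurable (translate k) :=
  measurable_pi_lambda _ fun x => measurable_pi_apply (x + k)

lemma translate_translate (j k : ℤ) (ω : Env) :
    translate j (translate k ω) = translate (j + k) ω := by
  funext x; simp [translate, add_assoc]

@[simp] lemma translate_zero (ω : Env) : translate 0 ω = ω := by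
  funext x; simp [translate]

lemma iterate_shift (n : ℕ) (ω : Env) : shift^[n] ω = translate n ω := by
  induction n with
  | zero => simp
  | succ n ih =>
    rw [Function.iterate_succ_apply', ih]
    funext x
    simp [translate, shift, add_comm, add_left_comm]

lemma measurePreserving_translate {P : Measure Env} (hP : MeasurePreserving shift P P) (k : ℤ) :
    MeasurePreserving (translate k) P P := by
  have hn (n : ℕ) : MeasurePreserving (translate n) P P := by
    have := hP.iterate n
    rwa [show shift^[n] = translate n from funext (iterate_shift n)] at this
  obtain ⟨n, rfl | rfl⟩ := k.eq_nat_or_neg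
  · exact hn n
  · refine ⟨measurable_translate _, ?_⟩
    conv_lhs => rw [← (hn n).map_eq]
    rw [Measure.map_map (measurable_translate _) (measurable_translate _)]
    have : translate (-(n : ℤ)) ∘ translate n = id := by
      funext ω; simp [translate_translate]
    rw [this, Measure.map_id]

/-- The partial sums `s_k` of `S̄`, at an arbitrary site. -/
noncomputable def partialS (ω : Env) (lam : ℝ) : ℕ → ℤ → ℝ
  | 0, _ => 0
  | k + 1, x => 1 / omegaPlus ω lam x + rho ω lam x * partialS ω lam k (x - 1)

/-- Truncated version of `partialS`, with values in `[0, K]`. -/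
noncomputable def truncS (ω : Env) (lam K : ℝ) : ℕ → ℤ → ℝ
  | 0, _ => 0
  | k + 1, x => min K (1 / omegaPlus ω lam x + rho ω lam x * truncS ω lam K k (x - 1))

lemma rho_pos (ω : Env) (lam : ℝ) (x : ℤ) : 0 < rho ω lam x :=
  div_pos (omegaMinus_pos ω lam x) (omegaPlus_pos ω lam x)

variable {ω : Env} {lam K : ℝ}

lemma truncS_nonneg (hK : 0 ≤ K) (k : ℕ) (x : ℤ) : 0 ≤ truncS ω lam K k x := by
  induction k generalizing x with
  | zero => exact le_rfl
  | succ k ih =>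
    exact le_min hK (add_nonneg (one_div_pos.2 (omegaPlus_pos ω lam x)).le
      (mul_nonneg (rho_pos ω lam x).le (ih _)))

lemma truncS_le (hK : 0 ≤ K) (k : ℕ) (x : ℤ) : truncS ω lam K k x ≤ K := by
  cases k with
  | zero => exact hK
  | succ k => exact min_le_left _ _

lemma truncS_le_succ (hK : 0 ≤ K) (k : ℕ) (x : ℤ) :
    truncS ω lam K k x ≤ truncS ω lam K (k + 1) x := by
  induction k generalizing x with
  | zero => exact truncS_nonneg hK _ _
  | succ k ih =>
    exact min_le_min le_rfl (add_le_add le_rfl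
      (mul_le_mul_of_nonneg_left (ih _) (rho_pos ω lam x).le))

lemma truncS_le_step (hK : 0 ≤ K) (k : ℕ) (x : ℤ) :
    truncS ω lam K k x ≤ 1 / omegaPlus ω lam x + rho ω lam x * truncS ω lam K k (x - 1) :=
  (truncS_le_succ hK k x).trans (min_le_right _ _)

/-- Multiplied by ω_x^+, the recursion would give drift exactly one. Truncation at K, and using k in
place of k + 1 on the left by monotonicity in k, only lower it. -/
lemma truncS_drift_le (hK : 0 ≤ K) (k : ℕ) (x : ℤ) :
    omegaPlus ω lam x * truncS ω lam K k x - omegaMinus ω lam x * truncS ω lam K k (x - 1) ≤ 1 := by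
  have h0 := omegaPlus_pos ω lam x
  have h := mul_le_mul_of_nonneg_left (truncS_le_step (ω := ω) (lam := lam) hK k x) h0.le
  have e : omegaPlus ω lam x * (1 / omegaPlus ω lam x + rho ω lam x * truncS ω lam K k (x - 1)) =
      1 + omegaMinus ω lam x * truncS ω lam K k (x - 1) := by
    unfold rho
    field_simp
  linarith

lemma truncS_translate (j : ℤ) (k : ℕ) (x : ℤ) :
    truncS (translate j ω) lam K k x = truncS ω lam K k (x + j) := by
  induction k generalizing x with
  | zero => rfl
  | succ k ih =>
    simp only [truncS, omegaPlus_translate, rho_translate, ih]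
    rw [show x - 1 + j = x + j - 1 by ring]

lemma measurable_truncS (lam K : ℝ) (k : ℕ) (x : ℤ) :
    Measurable fun ω => truncS ω lam K k x := by
  induction k generalizing x with
  | zero => exact measurable_const
  | succ k ih =>
    have := ih (x - 1)
    unfold truncS
    fun_prop

lemma tendsto_truncS (ω : Env) (lam : ℝ) (k : ℕ) (x : ℤ) :
    Tendsto (fun K : ℕ => truncS ω lam K k x) atTop (𝓝 (partialS ω lam k x)) := by
  induction k generalizing x with
  | zero => exact tendsto_const_nhds
  | succ k ih =>
    have h : Tendsto (fun K : ℕ => 1 / omegaPlus ω lam x + rho ω lam x * truncS ω lam K k (x - 1))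
        atTop (𝓝 (partialS ω lam (k + 1) x)) := ((ih (x - 1)).const_mul _).const_add _
    refine h.congr' ?_
    filter_upwards [h.eventually_lt_const (lt_add_one _),
      (tendsto_natCast_atTop_atTop (R := ℝ)).eventually_ge_atTop
        (partialS ω lam (k + 1) x + 1)] with n h1 h2
    exact (min_eq_right (h1.le.trans h2)).symm

lemma partialS_succ_eq (ω : Env) (lam : ℝ) (k : ℕ) (x : ℤ) :
    partialS ω lam (k + 1) x = 1 / omegaPlus ω lam x +
      ∑ i ∈ Finset.range k, 1 / omegaPlus ω lam (x - ((i : ℤ) + 1)) *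
        ∏ j ∈ Finset.range (i + 1), rho ω lam (x - (j : ℤ)) := by
  induction k generalizing x with
  | zero => simp [partialS]
  | succ k ih =>
    rw [partialS, ih, Finset.sum_range_succ', mul_add, Finset.mul_sum]
    simp only [Finset.prod_range_succ', Nat.cast_zero, sub_zero, Finset.range_zero,
      Finset.prod_empty, one_mul]
    rw [add_comm (rho ω lam x * _)]
    congr 1
    congr 1
    · refine Finset.sum_congr rfl fun i _ => ?_
      push_cast
      simp only [show ∀ a : ℤ, x - 1 - a = x - (a + 1) from fun a => by ring]
      ring
    · simp [mul_comm]

lemma tendsto_partialS (ω : Env) (lam : ℝ) :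
    Tendsto (fun k => ENNReal.ofReal (partialS ω lam (k + 1) 0)) atTop (𝓝 (Sbar ω lam)) := by
  have e (k : ℕ) : ENNReal.ofReal (partialS ω lam (k + 1) 0) =
      ENNReal.ofReal (1 / omegaPlus ω lam 0) + ∑ i ∈ Finset.range k,
        ENNReal.ofReal (1 / omegaPlus ω lam (-((i : ℤ) + 1)) *
          ∏ j ∈ Finset.range (i + 1), rho ω lam (-(j : ℤ))) := by
    have hpos (i : ℕ) : 0 ≤ 1 / omegaPlus ω lam (-((i : ℤ) + 1)) *
        ∏ j ∈ Finset.range (i + 1), rho ω lam (-(j : ℤ)) :=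
      mul_nonneg (one_div_pos.2 (omegaPlus_pos ω lam _)).le
        (Finset.prod_nonneg fun j _ => (rho_pos ω lam _).le)
    rw [partialS_succ_eq, ← ENNReal.ofReal_sum_of_nonneg fun i _ => hpos i,
      ← ENNReal.ofReal_add (one_div_pos.2 (omegaPlus_pos ω lam _)).le
        (Finset.sum_nonneg fun i _ => hpos i)]
    simp only [zero_sub]
  simp_rw [e]
  exact (ENNReal.tendsto_nat_tsum _).const_add _

/-- Truncation approximates the mean of `S̄` from below. -/
lemma exists_lt_lintegral_truncS {P : Measure Env} {lam : ℝ} {c : ℝ≥0∞}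
    (hc : c < meanSbar P lam) :
    ∃ K k : ℕ, c < ∫⁻ ω, ENNReal.ofReal (truncS ω lam K k 0) ∂P := by
  by_contra! H
  refine hc.not_ge ?_
  -- Fatou is used twice: here as K → ∞ for fixed k, then as k → ∞.
  have h1 (k : ℕ) : ∫⁻ ω, ENNReal.ofReal (partialS ω lam k 0) ∂P ≤ c := by
    have e : ∀ ω, ENNReal.ofReal (partialS ω lam k 0) =
        liminf (fun K : ℕ => ENNReal.ofReal (truncS ω lam K k 0)) atTop := fun ω =>
      ((ENNReal.continuous_ofReal.tendsto _).comp (tendsto_truncS ω lam k 0)).liminf_eq.symm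
    simp_rw [e]
    refine (lintegral_liminf_le (u := atTop) fun K : ℕ => (measurable_truncS lam K k 0).ennreal_ofReal).trans ?_
    exact (liminf_le_liminf (f := atTop) (v := fun _ : ℕ => c)
      (Eventually.of_forall fun K => H K k)).trans (liminf_const c).le
  have hm (k : ℕ) : Measurable fun ω => ENNReal.ofReal (partialS ω lam k 0) :=
    ENNReal.measurable_ofReal.comp (measurable_of_tendsto_metrizable
      (fun K : ℕ => measurable_truncS lam K k 0)
      (tendsto_pi_nhds.2 fun ω => tendsto_truncS ω lam k 0))
  unfold meanSbar
  have e : ∀ ω, Sbar ω lam = liminf (fun k => ENNReal.ofReal (partialS ω lam (k + 1) 0)) atTop :=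
    fun ω => (tendsto_partialS ω lam).liminf_eq.symm
  simp_rw [e]
  refine (lintegral_liminf_le (u := atTop) fun k : ℕ => hm (k + 1)).trans ?_
  exact (liminf_le_liminf (f := atTop) (v := fun _ : ℕ => c)
    (Eventually.of_forall fun k => h1 (k + 1))).trans (liminf_const c).le

/-- The function on `ℤ` with value `0` at `0` and increments `D`. -/
noncomputable def cumul (D : ℤ → ℝ) (x : ℤ) : ℝ :=
  ∑ k ∈ Finset.range x.toNat, D k - ∑ k ∈ Finset.range (-x).toNat, D (-1 - k)

lemma cumul_add_one (D : ℤ → ℝ) (x : ℤ) : cumul D (x + 1) = cumul D x + D x := by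
  unfold cumul
  rcases le_or_gt 0 x with h | h
  · rw [show (x + 1).toNat = x.toNat + 1 by omega, show (-(x + 1)).toNat = 0 by omega,
      show (-x).toNat = 0 by omega, Finset.sum_range_succ, Int.toNat_of_nonneg h]
    ring
  · rw [show (x + 1).toNat = 0 by omega, show x.toNat = 0 by omega,
      show (-x).toNat = (-(x + 1)).toNat + 1 by omega, Finset.sum_range_succ,
      Int.toNat_of_nonneg (by omega), show -1 - -(x + 1) = x by ring]
    ring

lemma cumul_natCast (D : ℤ → ℝ) (n : ℕ) : cumul D n = ∑ k ∈ Finset.range n, D k := by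
  simp [cumul]

/-- From e^u ≤ 1 + u + u² for |u| ≤ 1: the linear terms average to something nonpositive, and 1 +
t²C² ≤ exp(t²C²). -/
lemma weighted_exp_le {p q a b t C : ℝ} (hp : 0 ≤ p) (hq : 0 ≤ q) (hpq : p + q = 1) (ht : 0 ≤ t)
    (hC : t * C ≤ 1) (ha : |a| ≤ C) (hb : |b| ≤ C) (hab : p * a + q * b ≤ 0) :
    p * Real.exp (t * a) + q * Real.exp (t * b) ≤ Real.exp (t ^ 2 * C ^ 2) := by
  have key : ∀ u, |u| ≤ C → Real.exp (t * u) ≤ 1 + t * u + t ^ 2 * C ^ 2 := by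
    intro u hu
    have h1 : |t * u| ≤ t * C := by
      rw [abs_mul, abs_of_nonneg ht]; exact mul_le_mul_of_nonneg_left hu ht
    have h2 := (abs_le.1 (Real.abs_exp_sub_one_sub_id_le (h1.trans hC))).2
    have h3 : (t * u) ^ 2 ≤ (t * C) ^ 2 := sq_le_sq' (abs_le.1 h1).1 (abs_le.1 h1).2
    nlinarith
  have h1 := mul_le_mul_of_nonneg_left (key a ha) hp
  have h2 := mul_le_mul_of_nonneg_left (key b hb) hq
  have h3 := Real.add_one_le_exp (t ^ 2 * C ^ 2)
  have h4 : t * (p * a + q * b) ≤ 0 := mul_nonpos_of_nonneg_of_nonpos ht hab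
  have h5 : (p + q) * (1 + t ^ 2 * C ^ 2) = 1 + t ^ 2 * C ^ 2 := by rw [hpq, one_mul]
  nlinarith

/-- Exponential moments of a function of the walk that has bounded increments and drift at most
one. -/
lemma lintegral_exp_le {lam K t : ℝ} (ht : 0 ≤ t) (htK : t * (K + 1) ≤ 1) (n : ℕ)
    (ω : Env) (h : ℤ → ℝ) (h0 : ∀ x, 0 ≤ h (x + 1) - h x) (h1 : ∀ x, h (x + 1) - h x ≤ K)
    (h2 : ∀ x, omegaPlus ω lam x * (h (x + 1) - h x) -
      omegaMinus ω lam x * (h x - h (x - 1)) ≤ 1) :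
    ∫⁻ X, ENNReal.ofReal (Real.exp (t * (h (X n) - n))) ∂walkLaw ω lam ≤
      ENNReal.ofReal (Real.exp (t * h 0 + n * (t ^ 2 * (K + 1) ^ 2))) := by
  have hmeas (h : ℤ → ℝ) (n : ℕ) :
      Measurable fun X : ℕ → ℤ => ENNReal.ofReal (Real.exp (t * (h (X n) - n))) :=
    (measurable_of_countable fun x : ℤ => ENNReal.ofReal (Real.exp (t * (h x - n)))).comp
      (measurable_pi_apply n)
  induction n generalizing ω h with
  | zero =>
    have : ∀ᵐ X ∂walkLaw ω lam, ENNReal.ofReal (Real.exp (t * (h (X 0) - (0 : ℕ)))) =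
        ENNReal.ofReal (Real.exp (t * h 0)) := by
      filter_upwards [ae_walkLaw_zero ω lam] with X hX
      simp [hX]
    rw [lintegral_congr_ae this]
    simp
  | succ n ih =>
    -- After a first step s the walk restarts at 0 in the translated environment, with h replaced by
    -- x ↦ h(x + s). Hence the induction runs over all ω and h, without normalising h at 0.
    have step (s : ℤ) (hs2 : ∀ x, omegaPlus (translate s ω) lam x * (h (x + s + 1) - h (x + s)) -
        omegaMinus (translate s ω) lam x * (h (x + s) - h (x + s - 1)) ≤ 1) :
        ∫⁻ X, ENNReal.ofReal (Real.exp (t * (h (prepend s X (n + 1)) - (n + 1 : ℕ))))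
          ∂walkLaw (translate s ω) lam ≤
        ENNReal.ofReal (Real.exp (t * h 0 + n * (t ^ 2 * (K + 1) ^ 2)) *
          Real.exp (t * (h s - h 0 - 1))) := by
      have e (X : ℕ → ℤ) :
          ENNReal.ofReal (Real.exp (t * (h (prepend s X (n + 1)) - (n + 1 : ℕ)))) =
          ENNReal.ofReal (Real.exp (-t)) *
            ENNReal.ofReal (Real.exp (t * ((fun x => h (x + s)) (X n) - n))) := by
        rw [← ENNReal.ofReal_mul (Real.exp_pos _).le, ← Real.exp_add]
        congr 2
        simp only [prepend]
        push_cast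
        ring
      simp_rw [e]
      rw [lintegral_const_mul _ (hmeas (fun x => h (x + s)) n)]
      refine (mul_le_mul_right (ih (translate s ω) (fun x => h (x + s)) (fun x => ?_) (fun x => ?_)
        fun x => ?_) _).trans (le_of_eq ?_)
      · have := h0 (x + s); rwa [add_right_comm] at this
      · have := h1 (x + s); rwa [add_right_comm] at this
      · have := hs2 x
        rwa [add_right_comm x s 1, show x + s - 1 = x - 1 + s by ring] at this
      · rw [← ENNReal.ofReal_mul (Real.exp_pos _).le, ← Real.exp_add, ← Real.exp_add]
        congr 2
        simp only [zero_add]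
        ring
    have hs (s : ℤ) := step s fun x => h2 (x + s)
    rw [lintegral_walkLaw ω lam (hmeas h (n + 1))]
    refine (add_le_add (mul_le_mul_right (hs 1) _) (mul_le_mul_right (hs (-1)) _)).trans ?_
    have hp := omegaPlus_pos ω lam 0
    have hq := omegaMinus_pos ω lam 0
    rw [← ENNReal.ofReal_mul hp.le, ← ENNReal.ofReal_mul hq.le, ← ENNReal.ofReal_add
      (by positivity) (by positivity)]
    refine ENNReal.ofReal_le_ofReal ?_
    have a0 := h0 0
    have a1 := h1 0
    have b0 := h0 (-1)
    have b1 := h1 (-1)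
    have d := h2 0
    have pq := omegaPlus_add_omegaMinus ω lam 0
    simp only [zero_add, neg_add_cancel, zero_sub] at a0 a1 b0 b1 d
    -- The increments of h(X_n) - n lie between -(K+1) and K - 1, so C = K + 1 bounds them.
    have := weighted_exp_le (a := h 1 - h 0 - 1) (b := h (-1) - h 0 - 1) (C := K + 1) hp.le hq.le
      pq ht htK (abs_le.2 ⟨by linarith, by linarith⟩) (abs_le.2 ⟨by linarith, by linarith⟩)
      (by nlinarith)
    calc _ = Real.exp (t * h 0 + n * (t ^ 2 * (K + 1) ^ 2)) *
          (omegaPlus ω lam 0 * Real.exp (t * (h 1 - h 0 - 1)) +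
            omegaMinus ω lam 0 * Real.exp (t * (h (-1) - h 0 - 1))) := by ring
      _ ≤ Real.exp (t * h 0 + n * (t ^ 2 * (K + 1) ^ 2)) * Real.exp (t ^ 2 * (K + 1) ^ 2) :=
          mul_le_mul_of_nonneg_left this (Real.exp_pos _).le
      _ = _ := by
          rw [← Real.exp_add]
          congr 1
          push_cast
          ring

/-- Exponential Markov inequality and Borel–Cantelli. -/
lemma ae_eventually_le_of_drift_le {lam K : ℝ} (hK : 0 ≤ K)
    (ω : Env) (h : ℤ → ℝ) (hz : h 0 = 0) (h0 : ∀ x, 0 ≤ h (x + 1) - h x)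
    (h1 : ∀ x, h (x + 1) - h x ≤ K)
    (h2 : ∀ x, omegaPlus ω lam x * (h (x + 1) - h x) -
      omegaMinus ω lam x * (h x - h (x - 1)) ≤ 1) {δ : ℝ} (hδ : 0 < δ) :
    ∀ᵐ X ∂walkLaw ω lam, ∀ᶠ n : ℕ in atTop, h (X n) ≤ (1 + δ) * n := by
  set C := K + 1 with hC
  have hC0 : 0 < C := by positivity
  -- The first bound permits the quadratic estimate. The second keeps its cost n t²C² below half of
  -- the gain n t δ.
  set t := min (1 / C) (δ / (2 * C ^ 2)) with ht
  have ht0 : 0 < t := lt_min (by positivity) (by positivity)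
  have ht1 : t * C ≤ 1 := by
    have := mul_le_mul_of_nonneg_right (min_le_left (1 / C) (δ / (2 * C ^ 2))) hC0.le
    rwa [one_div_mul_cancel hC0.ne'] at this
  have ht2 : t * C ^ 2 ≤ δ / 2 := by
    have := mul_le_mul_of_nonneg_right (min_le_right (1 / C) (δ / (2 * C ^ 2))) (sq_nonneg C)
    have e : δ / (2 * C ^ 2) * C ^ 2 = δ / 2 := by field_simp
    rwa [e] at this
  have hbound (n : ℕ) : walkLaw ω lam {X | (1 + δ) * n < h (X n)} ≤
      ENNReal.ofReal (Real.exp (-(t * δ / 2))) ^ n := by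
    have hE := lintegral_exp_le ht0.le ht1 n ω h h0 h1 h2
    have hsub : {X : ℕ → ℤ | (1 + δ) * n < h (X n)} ⊆
        {X | ENNReal.ofReal (Real.exp (t * (δ * n))) ≤
          ENNReal.ofReal (Real.exp (t * (h (X n) - n)))} := by
      intro X hX
      simp only [Set.mem_ofPred_eq] at hX ⊢
      refine ENNReal.ofReal_le_ofReal (Real.exp_le_exp.2 (mul_le_mul_of_nonneg_left ?_ ht0.le))
      linarith
    have hmk := meas_ge_le_lintegral_div (μ := walkLaw ω lam)
      (f := fun X : ℕ → ℤ => ENNReal.ofReal (Real.exp (t * (h (X n) - n))))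
      ((measurable_of_countable fun x : ℤ => ENNReal.ofReal (Real.exp (t * (h x - n)))).comp
      (measurable_pi_apply n)).aemeasurable (ε := ENNReal.ofReal (Real.exp (t * (δ * n))))
      (by simp [Real.exp_pos]) ENNReal.ofReal_ne_top
    refine (measure_mono hsub).trans (hmk.trans ?_)
    refine (ENNReal.div_le_div_right hE _).trans ?_
    rw [← ENNReal.ofReal_div_of_pos (Real.exp_pos _), ← Real.exp_sub,
      ← ENNReal.ofReal_pow (Real.exp_pos _).le, ← Real.exp_nat_mul, hz]
    refine ENNReal.ofReal_le_ofReal (Real.exp_le_exp.2 ?_)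
    have : (n : ℝ) * (t * (t * C ^ 2)) ≤ n * (t * (δ / 2)) := by gcongr
    nlinarith
  have hsum : ∑' n : ℕ, walkLaw ω lam {X | (1 + δ) * n < h (X n)} ≠ ∞ := by
    refine ne_top_of_le_ne_top ?_ (ENNReal.tsum_le_tsum hbound)
    rw [ENNReal.tsum_geometric]
    refine ENNReal.inv_ne_top.2 (tsub_pos_of_lt ?_).ne'
    rw [ENNReal.ofReal_lt_one]
    exact Real.exp_lt_one_iff.2 (by have := mul_pos ht0 hδ; linarith)
  filter_upwards [ae_eventually_notMem hsum] with X hX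
  filter_upwards [hX] with n hn
  exact not_lt.1 hn

/-- The upper limit of `X_n / n` is at most `1 / E[S̄]`. -/
theorem ae_eventually_walk_le {P : Measure Env} [IsProbabilityMeasure P] (hP : Ergodic shift P)
    {lam c : ℝ} (hc : 0 < c) (h : ENNReal.ofReal (1 / c) < meanSbar P lam) :
    ∀ᵐ ω ∂P, ∀ᵐ X ∂walkLaw ω lam, ∀ᶠ n : ℕ in atTop, (X n : ℝ) ≤ c * n := by
  obtain ⟨K, k, hKk⟩ := exists_lt_lintegral_truncS h
  have hK : (0 : ℝ) ≤ K := Nat.cast_nonneg K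
  have hm := measurable_truncS lam K k 0
  have hint : Integrable (fun ω => truncS ω lam K k 0) P :=
    Integrable.of_bound hm.aestronglyMeasurable K (ae_of_all _ fun ω => by
      rw [Real.norm_of_nonneg (truncS_nonneg hK _ _)]; exact truncS_le hK _ _)
  rw [← ofReal_integral_eq_lintegral_ofReal hint (ae_of_all _ fun ω => truncS_nonneg hK _ _),
    ENNReal.ofReal_lt_ofReal_iff_of_nonneg (by positivity)] at hKk
  -- With 1/c < e < E[`truncS`], h(m) ≥ e m for large m, while h(X_n) ≤ c e n eventually (slack δ =
  -- c e - 1). So X_n > c n is impossible once c n ≥ N.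
  obtain ⟨e, he1, he2⟩ := exists_between hKk
  have he0 : 0 < e := lt_trans (by positivity) he1
  have hce : 1 < c * e := by rwa [div_lt_iff₀' hc] at he1
  filter_upwards [Ergodic.eventually_le_birkhoffSum hP hm hint he2] with ω hω
  set D : ℤ → ℝ := truncS ω lam K k with hD
  have hadd (x : ℤ) : cumul D (x + 1) - cumul D x = D x := by rw [cumul_add_one]; ring
  have hsub (x : ℤ) : cumul D x - cumul D (x - 1) = D (x - 1) := by
    have := hadd (x - 1); rwa [sub_add_cancel] at this
  filter_upwards [ae_eventually_le_of_drift_le (lam := lam) (K := K) hK ω (cumul D) (by simp [cumul])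
    (fun x => by rw [hadd]; exact truncS_nonneg hK _ _)
    (fun x => by rw [hadd]; exact truncS_le hK _ _)
    (fun x => by rw [hadd, hsub]; exact truncS_drift_le hK k x) (δ := c * e - 1)
    (by linarith)] with X hX
  rw [eventually_atTop] at hω
  obtain ⟨N, hN⟩ := hω
  filter_upwards [hX, (tendsto_natCast_atTop_atTop (R := ℝ)).eventually_ge_atTop (N / c)]
    with n hn hn'
  by_contra! hlt
  have h1 : (N : ℝ) < X n := by
    rw [div_le_iff₀' hc] at hn'
    exact hn'.trans_lt hlt
  have h2 : (N : ℤ) < X n := by exact_mod_cast h1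
  obtain ⟨m, hm⟩ := Int.eq_ofNat_of_zero_le (show 0 ≤ X n by omega)
  have h3 := hN m (by omega)
  have h4 : birkhoffSum shift (fun ω => truncS ω lam K k 0) m ω = cumul D m := by
    rw [cumul_natCast]
    simp only [birkhoffSum, iterate_shift, truncS_translate, zero_add, hD]
  rw [h4] at h3
  rw [hm] at hn hlt
  push_cast at hn hlt
  have : e * (c * n) < e * m := mul_lt_mul_of_pos_left hlt he0
  linarith

end UpperBound

/-! ### The environment viewed from the particle and the ballistic regime. -/

section EnvironmentProcess

lemma isVelocity_of_bounds {P : Measure Env} {lam v : ℝ}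
    (hu : ∀ c > v, ∀ᵐ ω ∂P, ∀ᵐ X ∂walkLaw ω lam, ∀ᶠ n : ℕ in atTop, (X n : ℝ) ≤ c * n)
    (hl : ∀ c < v, ∀ᵐ ω ∂P, ∀ᵐ X ∂walkLaw ω lam, ∀ᶠ n : ℕ in atTop, c * n ≤ (X n : ℝ)) :
    IsVelocity P lam v := by
  have hu' := ae_all_iff.2 fun k : ℕ => hu (v + 1 / (k + 1)) (by simp; positivity)
  have hl' := ae_all_iff.2 fun k : ℕ => hl (v - 1 / (k + 1)) (by simp; positivity)
  filter_upwards [hu', hl'] with ω h1 h2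
  filter_upwards [ae_all_iff.2 h1, ae_all_iff.2 h2] with X h3 h4
  rw [Metric.tendsto_nhds]
  intro ε hε
  obtain ⟨k, hk⟩ := exists_nat_one_div_lt hε
  filter_upwards [h3 k, h4 k, eventually_gt_atTop 0] with n h5 h6 hn
  have hn' : (0 : ℝ) < n := by exact_mod_cast hn
  rw [← div_le_iff₀ hn'] at h5
  rw [← le_div_iff₀ hn'] at h6
  rw [Real.dist_eq, abs_lt]
  constructor <;> linarith

/-- `1 + ∑_{i ≥ 1} ∏_{j = 1}^i ρ_j`. -/
noncomputable def rhoSeries (ω : Env) (lam : ℝ) : ℝ≥0∞ :=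
  ∑' i : ℕ, ENNReal.ofReal (∏ j ∈ Finset.range i, rho ω lam ((j : ℤ) + 1))

/-- The density, up to normalisation, of the invariant law of the environment viewed from the
particle. -/
noncomputable def invDensity (ω : Env) (lam : ℝ) : ℝ≥0∞ :=
  (1 + ENNReal.ofReal (rho ω lam 0)) * rhoSeries ω lam

lemma measurable_rhoSeries (lam : ℝ) : Measurable fun ω => rhoSeries ω lam :=
  Measurable.tsum fun i => by fun_prop

lemma measurable_invDensity (lam : ℝ) : Measurable fun ω => invDensity ω lam := by
  have := measurable_rhoSeries lam
  unfold invDensity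
  fun_prop

lemma rhoSeries_eq (ω : Env) (lam : ℝ) : rhoSeries ω lam =
    1 + ENNReal.ofReal (rho ω lam 1) * rhoSeries (translate 1 ω) lam := by
  unfold rhoSeries
  rw [tsum_eq_zero_add' ENNReal.summable, ← ENNReal.tsum_mul_left]
  congr 1
  · simp
  · refine tsum_congr fun i => ?_
    rw [← ENNReal.ofReal_mul (rho_pos ω lam 1).le, Finset.prod_range_succ', mul_comm]
    simp

lemma rhoSeries_translate_neg_one (ω : Env) (lam : ℝ) : rhoSeries (translate (-1) ω) lam =
    1 + ENNReal.ofReal (rho ω lam 0) * rhoSeries ω lam := by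
  rw [rhoSeries_eq]
  simp [translate_translate]

lemma one_div_omegaPlus (ω : Env) (lam : ℝ) (x : ℤ) :
    1 / omegaPlus ω lam x = 1 + rho ω lam x := by
  have h := omegaPlus_pos ω lam x
  unfold rho
  rw [one_add_div h.ne', omegaPlus_add_omegaMinus]

lemma ofReal_omegaPlus_mul (ω : Env) (lam : ℝ) (x : ℤ) :
    ENNReal.ofReal (omegaPlus ω lam x) * (1 + ENNReal.ofReal (rho ω lam x)) = 1 := by
  have h := omegaPlus_pos ω lam x
  rw [← ENNReal.ofReal_one, ← ENNReal.ofReal_add zero_le_one (rho_pos ω lam x).le,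
    ← ENNReal.ofReal_mul h.le, ← one_div_omegaPlus, mul_one_div_cancel h.ne']

lemma ofReal_omegaMinus_mul (ω : Env) (lam : ℝ) (x : ℤ) :
    ENNReal.ofReal (omegaMinus ω lam x) * (1 + ENNReal.ofReal (rho ω lam x)) =
      ENNReal.ofReal (rho ω lam x) := by
  have h := omegaPlus_pos ω lam x
  rw [← ENNReal.ofReal_one, ← ENNReal.ofReal_add zero_le_one (rho_pos ω lam x).le,
    ← ENNReal.ofReal_mul (omegaMinus_pos ω lam x).le, ← one_div_omegaPlus, mul_one_div, rho]

lemma one_le_rhoSeries (ω : Env) (lam : ℝ) : 1 ≤ rhoSeries ω lam := by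
  rw [rhoSeries_eq]
  exact le_self_add

/-- Read from site -i, the i-th term of S̄ is the i-th term of `invDensity`; by stationarity the two
means agree. -/
lemma Sbar_eq_tsum (ω : Env) (lam : ℝ) : Sbar ω lam =
    ∑' i : ℕ, (1 + ENNReal.ofReal (rho (translate (-i) ω) lam 0)) *
      ENNReal.ofReal (∏ j ∈ Finset.range i, rho (translate (-i) ω) lam ((j : ℤ) + 1)) := by
  have e (x : ℤ) : 1 + ENNReal.ofReal (rho ω lam x) = ENNReal.ofReal (1 / omegaPlus ω lam x) := by
    rw [one_div_omegaPlus, ENNReal.ofReal_add zero_le_one (rho_pos ω lam x).le,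
      ENNReal.ofReal_one]
  symm
  rw [tsum_eq_zero_add' ENNReal.summable, Sbar]
  congr 1
  · simp [e]
  · refine tsum_congr fun i => ?_
    rw [ENNReal.ofReal_mul (one_div_pos.2 (omegaPlus_pos ω lam _)).le, ← e, rho_translate,
      ← Finset.prod_range_reflect (n := i + 1)]
    push_cast
    rw [zero_add]
    congr 2
    refine Finset.prod_congr rfl fun j hj => ?_
    have := Finset.mem_range.1 hj
    rw [rho_translate]
    congr 1
    push_cast [show i + 1 - 1 - j = i - j by omega, Nat.cast_sub (show j ≤ i by omega)]
    ring

lemma lintegral_translate {P : Measure Env} (hP : MeasurePreserving shift P P) (k : ℤ)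
    {F : Env → ℝ≥0∞} (hF : Measurable F) :
    ∫⁻ ω, F (translate k ω) ∂P = ∫⁻ ω, F ω ∂P :=
  (measurePreserving_translate hP k).lintegral_comp hF

lemma lintegral_invDensity {P : Measure Env} (hP : MeasurePreserving shift P P) (lam : ℝ) :
    ∫⁻ ω, invDensity ω lam ∂P = meanSbar P lam := by
  have hm (i : ℕ) : Measurable fun ω => (1 + ENNReal.ofReal (rho ω lam 0)) *
      ENNReal.ofReal (∏ j ∈ Finset.range i, rho ω lam ((j : ℤ) + 1)) := by fun_prop
  have hm' (i : ℕ) : Measurable fun ω => (1 + ENNReal.ofReal (rho (translate (-i) ω) lam 0)) *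
      ENNReal.ofReal (∏ j ∈ Finset.range i, rho (translate (-i) ω) lam ((j : ℤ) + 1)) :=
    (hm i).comp (measurable_translate _)
  unfold meanSbar invDensity rhoSeries
  simp_rw [Sbar_eq_tsum, ← ENNReal.tsum_mul_left]
  rw [lintegral_tsum fun i => (hm i).aemeasurable,
    lintegral_tsum fun i => (hm' i).aemeasurable]
  exact tsum_congr fun i => (lintegral_translate hP (-i) (hm i)).symm

/-- The measure with density `invDensity` is invariant for the environment viewed from the
particle. -/
lemma lintegral_invDensity_step {P : Measure Env} (hP : MeasurePreserving shift P P) (lam : ℝ)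
    {G : Env → ℝ≥0∞} (hG : Measurable G) :
    ∫⁻ ω, invDensity ω lam * (ENNReal.ofReal (omegaPlus ω lam 0) * G (translate 1 ω) +
      ENNReal.ofReal (omegaMinus ω lam 0) * G (translate (-1) ω)) ∂P =
    ∫⁻ ω, invDensity ω lam * G ω ∂P := by
  have hg := measurable_rhoSeries lam
  have ht := measurable_translate
  have e (ω : Env) : invDensity ω lam * (ENNReal.ofReal (omegaPlus ω lam 0) * G (translate 1 ω) +
      ENNReal.ofReal (omegaMinus ω lam 0) * G (translate (-1) ω)) =
      rhoSeries ω lam * G (translate 1 ω) +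
        ENNReal.ofReal (rho ω lam 0) * rhoSeries ω lam * G (translate (-1) ω) := by
    rw [invDensity]
    calc _ = (ENNReal.ofReal (omegaPlus ω lam 0) * (1 + ENNReal.ofReal (rho ω lam 0))) *
          (rhoSeries ω lam * G (translate 1 ω)) +
          (ENNReal.ofReal (omegaMinus ω lam 0) * (1 + ENNReal.ofReal (rho ω lam 0))) *
          (rhoSeries ω lam * G (translate (-1) ω)) := by ring
      _ = _ := by rw [ofReal_omegaPlus_mul, ofReal_omegaMinus_mul]; ring
  simp_rw [e]
  have hm1 : Measurable fun ω => rhoSeries ω lam * G (translate 1 ω) := hg.mul (hG.comp (ht 1))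
  have hm2 : Measurable fun ω =>
      ENNReal.ofReal (rho ω lam 0) * rhoSeries ω lam * G (translate (-1) ω) :=
    (((measurable_rho lam 0).ennreal_ofReal).mul hg).mul (hG.comp (ht (-1)))
  have hm1' : Measurable fun ω =>
      rhoSeries (translate (-1) ω) lam * G (translate 1 (translate (-1) ω)) := hm1.comp (ht (-1))
  -- Each term is translated so that G is evaluated at ω. With g = `rhoSeries`, it remains to check
  -- 1 + ρ_0 g + ρ_1 g∘τ_1 = (1 + ρ_0) g, which follows from g = 1 + ρ_1 g∘τ_1.
  rw [lintegral_add_left hm1, ← lintegral_translate hP (-1) hm1, ← lintegral_translate hP 1 hm2,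
    ← lintegral_add_left hm1']
  refine lintegral_congr fun ω => ?_
  simp only [translate_translate, rho_translate, Int.reduceNeg, add_neg_cancel, neg_add_cancel,
    translate_zero, zero_add, rhoSeries_translate_neg_one, invDensity]
  rw [add_mul 1 (ENNReal.ofReal _) (rhoSeries ω lam), one_mul]
  conv_rhs => rw [rhoSeries_eq ω lam]
  conv_lhs => rw [rhoSeries_eq ω lam]
  ring

/-- The invariant law of the environment viewed from the particle. -/
noncomputable def envLaw (P : Measure Env) (lam : ℝ) : Measure Env :=
  P.withDensity fun ω => (meanSbar P lam)⁻¹ * invDensity ω lam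

lemma lintegral_envLaw {P : Measure Env} (lam : ℝ) {F : Env → ℝ≥0∞} (hF : Measurable F) :
    ∫⁻ ω, F ω ∂envLaw P lam = (meanSbar P lam)⁻¹ * ∫⁻ ω, invDensity ω lam * F ω ∂P := by
  have := measurable_invDensity lam
  have hm : Measurable fun ω => invDensity ω lam * F ω := this.mul hF
  rw [envLaw, lintegral_withDensity_eq_lintegral_mul _ (this.const_mul _) hF,
    ← lintegral_const_mul _ hm]
  simp [mul_assoc]

lemma one_le_meanSbar {P : Measure Env} [IsProbabilityMeasure P]
    (hP : MeasurePreserving shift P P) (lam : ℝ) : 1 ≤ meanSbar P lam := by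
  rw [← lintegral_invDensity hP]
  calc (1 : ℝ≥0∞) = ∫⁻ _, 1 ∂P := by simp
    _ ≤ _ := lintegral_mono fun ω => one_le_mul le_self_add (one_le_rhoSeries ω lam)

lemma isProbabilityMeasure_envLaw {P : Measure Env} [IsProbabilityMeasure P]
    (hP : MeasurePreserving shift P P) {lam : ℝ} (h : meanSbar P lam ≠ ∞) :
    IsProbabilityMeasure (envLaw P lam) := ⟨by
  have := lintegral_envLaw (P := P) lam (F := fun _ => 1) measurable_const
  simp only [lintegral_const, one_mul, mul_one] at this
  rw [this, lintegral_invDensity hP, ENNReal.inv_mul_cancel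
    (zero_lt_one.trans_le (one_le_meanSbar hP lam)).ne' h]⟩

lemma absolutelyContinuous_envLaw {P : Measure Env} {lam : ℝ} (h : meanSbar P lam ≠ ∞) :
    P ≪ envLaw P lam := by
  refine withDensity_absolutelyContinuous' ((measurable_invDensity lam).const_mul _).aemeasurable
    (ae_of_all _ fun ω => mul_ne_zero (ENNReal.inv_ne_zero.2 h) ?_)
  exact (zero_lt_one.trans_le (one_le_mul le_self_add (one_le_rhoSeries ω lam))).ne'

/-- The dynamics of environment and path viewed from the particle. -/
def moveFrame (p : Env × (ℕ → ℤ)) : Env × (ℕ → ℤ) :=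
  (translate (p.2 1) p.1, fun n => p.2 (n + 1) - p.2 1)

lemma measurable_moveFrame : Measurable moveFrame := by
  have h1 : Measurable fun q : Env × ℤ => translate q.2 q.1 :=
    measurable_from_prod_countable_left fun k => measurable_translate k
  have h2 : Measurable fun p : Env × (ℕ → ℤ) => p.2 1 := by fun_prop
  exact (h1.comp (measurable_fst.prodMk h2)).prodMk (by fun_prop)

lemma moveFrame_prepend (s : ℤ) (ω : Env) {X : ℕ → ℤ} (hX : X 0 = 0) :
    moveFrame (ω, prepend s X) = (translate s ω, X) := by
  ext <;> simp [moveFrame, prepend, hX]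

/-- The Markov property at time one reduces invariance on the joint space to that of the environment
law, tested on the quenched means of F. -/
lemma measurePreserving_moveFrame {P : Measure Env} [IsProbabilityMeasure P]
    (hP : MeasurePreserving shift P P) {lam : ℝ} (h : meanSbar P lam ≠ ∞) :
    MeasurePreserving moveFrame (envLaw P lam ⊗ₘ walkKernel lam)
      (envLaw P lam ⊗ₘ walkKernel lam) := by
  have := isProbabilityMeasure_envLaw hP h
  refine ⟨measurable_moveFrame, Measure.ext_of_lintegral _ fun F hF => ?_⟩
  have hH : Measurable fun ω => ∫⁻ X, F (ω, X) ∂walkLaw ω lam :=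
    hF.lintegral_kernel_prod_right' (κ := walkKernel lam)
  have hinner (ω : Env) : ∫⁻ X, F (moveFrame (ω, X)) ∂walkLaw ω lam =
      ENNReal.ofReal (omegaPlus ω lam 0) *
        (fun ω => ∫⁻ X, F (ω, X) ∂walkLaw ω lam) (translate 1 ω) +
      ENNReal.ofReal (omegaMinus ω lam 0) *
        (fun ω => ∫⁻ X, F (ω, X) ∂walkLaw ω lam) (translate (-1) ω) := by
    rw [lintegral_walkLaw ω lam (F := fun X => F (moveFrame (ω, X)))
      (hF.comp (measurable_moveFrame.comp measurable_prodMk_left))]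
    have e (s : ℤ) : ∫⁻ X, F (moveFrame (ω, prepend s X)) ∂walkLaw (translate s ω) lam =
        ∫⁻ X, F (translate s ω, X) ∂walkLaw (translate s ω) lam := by
      refine lintegral_congr_ae ?_
      filter_upwards [ae_walkLaw_zero (translate s ω) lam] with X hX
      rw [moveFrame_prepend s ω hX]
    rw [e, e]
  have hm : Measurable fun ω => ∫⁻ X, F (moveFrame (ω, X)) ∂walkLaw ω lam :=
    (hF.comp measurable_moveFrame).lintegral_kernel_prod_right' (κ := walkKernel lam)
  have hFm : Measurable fun p => F (moveFrame p) := hF.comp measurable_moveFrame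
  rw [lintegral_map hF measurable_moveFrame, Measure.lintegral_compProd hFm,
    Measure.lintegral_compProd hF]
  simp only [walkKernel_apply]
  rw [lintegral_envLaw lam hm, lintegral_envLaw lam hH]
  simp_rw [hinner]
  rw [lintegral_invDensity_step hP lam hH]

lemma lintegral_first_step (ω : Env) (lam : ℝ) (φ : ℤ → ℝ≥0∞) :
    ∫⁻ X, φ (X 1 - X 0) ∂walkLaw ω lam = ENNReal.ofReal (omegaPlus ω lam 0) * φ 1 +
      ENNReal.ofReal (omegaMinus ω lam 0) * φ (-1) := by
  have hφ : Measurable φ := measurable_of_countable φ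
  rw [lintegral_walkLaw ω lam (F := fun X => φ (X 1 - X 0)) (by fun_prop)]
  have e (s : ℤ) : ∫⁻ X, φ (prepend s X 1 - prepend s X 0) ∂walkLaw (translate s ω) lam =
      φ s := by
    have : ∀ᵐ X ∂walkLaw (translate s ω) lam, φ (prepend s X 1 - prepend s X 0) = φ s := by
      filter_upwards [ae_walkLaw_zero (translate s ω) lam] with X hX
      simp [prepend, hX]
    rw [lintegral_congr_ae this]
    simp
  rw [e, e]

/-- The first step of the walk, as a function on the joint space of environments and paths. -/
def firstStep (p : Env × (ℕ → ℤ)) : ℝ := ((p.2 1 - p.2 0 : ℤ) : ℝ)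

lemma measurable_firstStep : Measurable firstStep :=
  (measurable_of_countable fun k : ℤ => (k : ℝ)).comp
    (by fun_prop : Measurable fun p : Env × (ℕ → ℤ) => p.2 1 - p.2 0)

lemma birkhoffSum_firstStep (n : ℕ) (p : Env × (ℕ → ℤ)) :
    birkhoffSum moveFrame firstStep n p = p.2 n - p.2 0 := by
  induction n generalizing p with
  | zero => simp
  | succ n ih =>
    rw [birkhoffSum_succ', ih]
    simp only [firstStep, moveFrame]
    push_cast
    ring

/-- Since ω_0^+(1 + ρ_0) = 1 and ω_0^-(1 + ρ_0) = ρ_0, right and left steps have unnormalised masses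
E[g] and E[ρ_0 g], with g = `rhoSeries`. A general φ covers the norm and both signed parts. -/
lemma lintegral_firstStep {P : Measure Env} [IsProbabilityMeasure P]
    (hP : MeasurePreserving shift P P) {lam : ℝ} (h : meanSbar P lam ≠ ∞) (φ : ℝ → ℝ≥0∞)
    (hφ : Measurable φ) :
    ∫⁻ p, φ (firstStep p) ∂(envLaw P lam ⊗ₘ walkKernel lam) =
      (meanSbar P lam)⁻¹ * ((∫⁻ ω, rhoSeries ω lam ∂P) * φ 1 +
        (∫⁻ ω, ENNReal.ofReal (rho ω lam 0) * rhoSeries ω lam ∂P) * φ (-1)) := by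
  have := isProbabilityMeasure_envLaw hP h
  have hg := measurable_rhoSeries lam
  have hr := (measurable_rho lam 0).ennreal_ofReal
  have hrg : Measurable fun ω => ENNReal.ofReal (rho ω lam 0) * rhoSeries ω lam := hr.mul hg
  have hφ' : Measurable fun p => φ (firstStep p) := hφ.comp measurable_firstStep
  rw [Measure.lintegral_compProd hφ']
  simp only [walkKernel_apply, firstStep]
  have e (ω : Env) := lintegral_first_step ω lam fun k => φ k
  simp only [Int.cast_one, Int.cast_neg] at e
  simp_rw [e]
  rw [lintegral_envLaw lam (by fun_prop), ← lintegral_mul_const _ hg,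
    ← lintegral_mul_const _ hrg, ← lintegral_add_left (hg.mul_const _)]
  congr 1
  refine lintegral_congr fun ω => ?_
  rw [invDensity]
  calc _ = (ENNReal.ofReal (omegaPlus ω lam 0) * (1 + ENNReal.ofReal (rho ω lam 0))) *
        rhoSeries ω lam * φ 1 +
        (ENNReal.ofReal (omegaMinus ω lam 0) * (1 + ENNReal.ofReal (rho ω lam 0))) *
        rhoSeries ω lam * φ (-1) := by ring
    _ = _ := by rw [ofReal_omegaPlus_mul, ofReal_omegaMinus_mul, one_mul]

/-- By stationarity the mass of right steps exceeds that of left steps by exactly one: the numerator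
of the speed. -/
lemma lintegral_rhoSeries {P : Measure Env} [IsProbabilityMeasure P]
    (hP : MeasurePreserving shift P P) (lam : ℝ) : ∫⁻ ω, rhoSeries ω lam ∂P =
      1 + ∫⁻ ω, ENNReal.ofReal (rho ω lam 0) * rhoSeries ω lam ∂P := by
  rw [← lintegral_translate hP (-1) (measurable_rhoSeries lam)]
  simp_rw [rhoSeries_translate_neg_one]
  rw [lintegral_add_left measurable_const]
  simp

lemma lintegral_rho_mul_rhoSeries_ne_top {P : Measure Env} (hP : MeasurePreserving shift P P)
    {lam : ℝ} (h : meanSbar P lam ≠ ∞) :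
    ∫⁻ ω, ENNReal.ofReal (rho ω lam 0) * rhoSeries ω lam ∂P ≠ ∞ := by
  refine ne_top_of_le_ne_top h ?_
  rw [← lintegral_invDensity hP]
  exact lintegral_mono fun ω => mul_le_mul_left le_add_self _

lemma integrable_firstStep {P : Measure Env} [IsProbabilityMeasure P]
    (hP : MeasurePreserving shift P P) {lam : ℝ} (h : meanSbar P lam ≠ ∞) :
    Integrable firstStep (envLaw P lam ⊗ₘ walkKernel lam) := by
  refine ⟨measurable_firstStep.aestronglyMeasurable, ?_⟩
  have h0 : meanSbar P lam ≠ 0 := (zero_lt_one.trans_le (one_le_meanSbar hP lam)).ne'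
  have hb := lintegral_rho_mul_rhoSeries_ne_top hP h
  rw [HasFiniteIntegral, lintegral_firstStep hP h (fun x => ‖x‖ₑ) measurable_enorm,
    lintegral_rhoSeries hP]
  refine ENNReal.mul_lt_top (ENNReal.inv_lt_top.2 (pos_iff_ne_zero.2 h0)) ?_
  simp [hb.lt_top]

lemma integral_firstStep {P : Measure Env} [IsProbabilityMeasure P]
    (hP : MeasurePreserving shift P P) {lam : ℝ} (h : meanSbar P lam ≠ ∞) :
    ∫ p, firstStep p ∂(envLaw P lam ⊗ₘ walkKernel lam) = 1 / (meanSbar P lam).toReal := by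
  have hb := lintegral_rho_mul_rhoSeries_ne_top hP h
  rw [integral_eq_lintegral_pos_part_sub_lintegral_neg_part (integrable_firstStep hP h),
    lintegral_firstStep hP h (fun x => ENNReal.ofReal x) ENNReal.measurable_ofReal,
    lintegral_firstStep hP h (fun x => ENNReal.ofReal (-x)) (by fun_prop),
    lintegral_rhoSeries hP]
  simp only [ENNReal.ofReal_one, mul_one, neg_neg, add_zero, zero_add, mul_zero,
    ENNReal.ofReal_of_nonpos (show (-1 : ℝ) ≤ 0 by norm_num)]
  rw [ENNReal.toReal_mul, ENNReal.toReal_mul, ENNReal.toReal_add ENNReal.one_ne_top hb,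
    ENNReal.toReal_inv, ENNReal.toReal_one]
  ring

lemma measurableSet_eventually_walk_le (c : ℝ) :
    MeasurableSet {p : Env × (ℕ → ℤ) | ∀ᶠ n : ℕ in atTop, (p.2 n : ℝ) ≤ c * n} := by
  have hmn (n : ℕ) : Measurable fun p : Env × (ℕ → ℤ) => (p.2 n : ℝ) :=
    (measurable_of_countable fun k : ℤ => (k : ℝ)).comp
      (by fun_prop : Measurable fun p : Env × (ℕ → ℤ) => p.2 n)
  have : {p : Env × (ℕ → ℤ) | ∀ᶠ n : ℕ in atTop, (p.2 n : ℝ) ≤ c * n} =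
      ⋃ N : ℕ, ⋂ n : ℕ, ⋂ _ : N ≤ n, {p | (p.2 n : ℝ) ≤ c * n} := by
    ext p
    simp [eventually_atTop]
  rw [this]
  exact .iUnion fun N => .iInter fun n => .iInter fun _ =>
    measurableSet_le (hmn n) measurable_const

lemma ae_birkhoffSum_firstStep {P : Measure Env} [IsProbabilityMeasure P]
    (hP : MeasurePreserving shift P P) {lam : ℝ} (h : meanSbar P lam ≠ ∞) :
    ∀ᵐ p ∂(envLaw P lam ⊗ₘ walkKernel lam),
      ∀ n, birkhoffSum moveFrame firstStep n p = p.2 n := by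
  have := isProbabilityMeasure_envLaw hP h
  have hm : MeasurableSet {p : Env × (ℕ → ℤ) | p.2 0 = 0} :=
    (by fun_prop : Measurable fun p : Env × (ℕ → ℤ) => p.2 0) (measurableSet_singleton 0)
  have hae : ∀ᵐ p ∂(envLaw P lam ⊗ₘ walkKernel lam), p.2 0 = 0 :=
    Measure.ae_compProd_of_ae_ae hm (ae_of_all _ fun ω => ae_walkLaw_zero ω lam)
  filter_upwards [hae] with p hp n
  rw [birkhoffSum_firstStep, hp, Int.cast_zero, sub_zero]

/-- The ballistic regime. -/
theorem isVelocity_of_meanSbar_ne_top {P : Measure Env} [IsProbabilityMeasure P]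
    (hP : Ergodic shift P) {lam : ℝ} (h : meanSbar P lam ≠ ∞) :
    IsVelocity P lam (1 / (meanSbar P lam).toReal) := by
  have hS := hP.toMeasurePreserving
  have := isProbabilityMeasure_envLaw hS h
  have hm0 : 0 < (meanSbar P lam).toReal :=
    ENNReal.toReal_pos (zero_lt_one.trans_le (one_le_meanSbar hS lam)).ne' h
  have hv0 : 0 < 1 / (meanSbar P lam).toReal := by positivity
  have hup : ∀ c > 1 / (meanSbar P lam).toReal,
      ∀ᵐ ω ∂P, ∀ᵐ X ∂walkLaw ω lam, ∀ᶠ n : ℕ in atTop, (X n : ℝ) ≤ c * n := by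
    intro c hc
    refine ae_eventually_walk_le hP (hv0.trans hc) ?_
    rw [← ENNReal.ofReal_toReal h, ENNReal.ofReal_lt_ofReal_iff hm0]
    exact (one_div_lt (hv0.trans hc) hm0).2 hc
  refine isVelocity_of_bounds hup fun c hc => ?_
  have hI := integral_firstStep hS h
  have hS0 := ae_birkhoffSum_firstStep hS h
  have hup' : ∀ d > ∫ p, firstStep p ∂(envLaw P lam ⊗ₘ walkKernel lam),
      ∀ᵐ p ∂(envLaw P lam ⊗ₘ walkKernel lam), ∀ᶠ n : ℕ in atTop,
        birkhoffSum moveFrame firstStep n p ≤ d * n := by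
    intro d hd
    rw [hI] at hd
    -- The upper bound passes from P to `envLaw` by absolute continuity; at the end the lower bound
    -- passes back because the density is positive.
    have hQ : ∀ᵐ ω ∂envLaw P lam, ∀ᵐ X ∂walkKernel lam ω,
        ∀ᶠ n : ℕ in atTop, (X n : ℝ) ≤ d * n :=
      (withDensity_absolutelyContinuous P _).ae_le (hup d hd)
    have hae := Measure.ae_compProd_of_ae_ae (measurableSet_eventually_walk_le d) hQ
    filter_upwards [hae, hS0] with p hp hp0
    simpa only [hp0] using hp
  have hlow := eventually_le_birkhoffSum_of_upper (measurePreserving_moveFrame hS h)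
    measurable_firstStep (integrable_firstStep hS h) hup' (hc.trans_eq hI.symm)
  have hae : ∀ᵐ p ∂(envLaw P lam ⊗ₘ walkKernel lam),
      ∀ᶠ n : ℕ in atTop, c * n ≤ (p.2 n : ℝ) := by
    filter_upwards [hlow, hS0] with p hp hp0
    simpa only [hp0] using hp
  have hae' : ∀ᵐ ω ∂envLaw P lam, ∀ᵐ X ∂walkKernel lam ω, ∀ᶠ n : ℕ in atTop, c * n ≤ (X n : ℝ) :=
    Measure.ae_ae_of_ae_compProd hae
  exact (absolutelyContinuous_envLaw h).ae_le hae'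

end EnvironmentProcess

/-! ### Reflection: zero speed, oddness and even derivatives. -/

section Final

lemma rho_reflect (ω : Env) (x : ℤ) : rho (reflect ω) 0 x = (rho ω 0 (-x))⁻¹ := by
  rw [rho, omegaMinus_reflect, omegaPlus_reflect, neg_zero, rho, inv_div]

lemma rho_le_rho_neg (ω : Env) {lam : ℝ} (h : 0 ≤ lam) (x : ℤ) : rho ω 0 x ≤ rho ω (-lam) x := by
  have h0 : 0 < (ω x : ℝ) := (ω x).2.1
  have h1 : 0 < 1 - (ω x : ℝ) := sub_pos.2 (ω x).2.2
  have e (l : ℝ) : rho ω l x = (1 - (ω x : ℝ)) / ω x * (Real.exp (-l) / Real.exp l) := by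
    have := denom_pos ω l x
    unfold rho omegaMinus omegaPlus
    field_simp
  rw [e, e]
  refine mul_le_mul_of_nonneg_left ?_ (by positivity)
  rw [neg_neg, ← Real.exp_sub, ← Real.exp_sub]
  exact Real.exp_le_exp.2 (by linarith)

/-- Reflection composed with a translation preserves P and turns the product Y into 1/Y. So 2 E[Y] =
E[Y + 1/Y] ≥ 2. -/
lemma one_le_lintegral_prod_rho {P : Measure Env} [IsProbabilityMeasure P]
    (hP : MeasurePreserving shift P P) (hR : ReflectionInvariant P) (k : ℕ) :
    1 ≤ ∫⁻ ω, ENNReal.ofReal (∏ j ∈ Finset.range (k + 1), rho ω 0 (-(j : ℤ))) ∂P := by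
  set Y : Env → ℝ := fun ω => ∏ j ∈ Finset.range (k + 1), rho ω 0 (-(j : ℤ)) with hY
  have hYm : Measurable Y := by fun_prop
  have hY0 (ω : Env) : 0 < Y ω := Finset.prod_pos fun j _ => rho_pos ω 0 _
  have hY' (ω : Env) : Y (reflect (translate (-k) ω)) = (Y ω)⁻¹ := by
    simp only [hY, rho_reflect, rho_translate, neg_neg]
    rw [Finset.prod_inv_distrib, ← Finset.prod_range_reflect]
    congr 1
    refine Finset.prod_congr rfl fun j hj => ?_
    have := Finset.mem_range.1 hj
    congr 1
    push_cast [show k + 1 - 1 - j = k - j by omega, Nat.cast_sub (show j ≤ k by omega)]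
    ring
  have h1 : ∫⁻ ω, ENNReal.ofReal (Y ω)⁻¹ ∂P = ∫⁻ ω, ENNReal.ofReal (Y ω) ∂P := by
    have hm : Measurable fun ω => ENNReal.ofReal (Y (reflect ω)) :=
      hYm.ennreal_ofReal.comp hR.measurable
    simp_rw [← hY']
    rw [lintegral_translate hP (-k) hm]
    exact hR.lintegral_comp hYm.ennreal_ofReal
  have h2 : (2 : ℝ≥0∞) ≤ ∫⁻ ω, ENNReal.ofReal (Y ω) ∂P + ∫⁻ ω, ENNReal.ofReal (Y ω) ∂P := by
    nth_rw 2 [← h1]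
    rw [← lintegral_add_left hYm.ennreal_ofReal]
    calc (2 : ℝ≥0∞) = ∫⁻ _, ENNReal.ofReal 2 ∂P := by simp
      _ ≤ _ := lintegral_mono fun ω => by
        rw [← ENNReal.ofReal_add (hY0 ω).le (inv_pos.2 (hY0 ω)).le]
        refine ENNReal.ofReal_le_ofReal ?_
        have h := hY0 ω
        have e : Y ω + (Y ω)⁻¹ - 2 = (Y ω - 1) ^ 2 / Y ω := by field_simp; ring
        have : 0 ≤ (Y ω - 1) ^ 2 / Y ω := by positivity
        linarith
  by_contra! hlt
  have := ENNReal.add_lt_add hlt hlt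
  rw [one_add_one_eq_two] at this
  exact this.not_ge h2

/-- The bias -λ ≤ 0 only increases each ρ_x, so every term of the series has mean at least 1. -/
lemma meanSbar_neg_eq_top {P : Measure Env} [IsProbabilityMeasure P]
    (hP : MeasurePreserving shift P P) (hR : ReflectionInvariant P) {lam : ℝ} (h : 0 ≤ lam) :
    meanSbar P (-lam) = ∞ := by
  have hle (ω : Env) : ∑' k : ℕ,
      ENNReal.ofReal (∏ j ∈ Finset.range (k + 1), rho ω 0 (-(j : ℤ))) ≤ Sbar ω (-lam) := by
    refine le_add_left (ENNReal.tsum_le_tsum fun k => ENNReal.ofReal_le_ofReal ?_)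
    have h1 : ∏ j ∈ Finset.range (k + 1), rho ω 0 (-(j : ℤ)) ≤
        ∏ j ∈ Finset.range (k + 1), rho ω (-lam) (-(j : ℤ)) :=
      Finset.prod_le_prod (fun j _ => (rho_pos ω 0 _).le) fun j _ => rho_le_rho_neg ω h _
    refine h1.trans (le_mul_of_one_le_left
      (Finset.prod_nonneg fun j _ => (rho_pos ω _ _).le) ?_)
    rw [one_div_omegaPlus]
    linarith [rho_pos ω (-lam) (-((k : ℤ) + 1))]
  refine top_le_iff.1 (le_trans ?_ (lintegral_mono hle))
  rw [lintegral_tsum fun k => (by fun_prop : Measurable fun ω : Env =>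
    ENNReal.ofReal (∏ j ∈ Finset.range (k + 1), rho ω 0 (-(j : ℤ)))).aemeasurable]
  rw [← ENNReal.tsum_const_eq_top_of_ne_zero (α := ℕ) one_ne_zero]
  exact ENNReal.tsum_le_tsum fun k => one_le_lintegral_prod_rho hP hR k

lemma ae_reflect {P : Measure Env} (hR : ReflectionInvariant P) {lam : ℝ}
    {p : (ℕ → ℤ) → Prop}
    (h : ∀ᵐ ω ∂P, ∀ᵐ X ∂walkLaw ω lam, p X) :
    ∀ᵐ ω ∂P, ∀ᵐ X ∂walkLaw ω (-lam), p (-X) := by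
  filter_upwards [hR.quasiMeasurePreserving.ae h] with ω hω
  rw [walkLaw_reflect] at hω
  exact ae_of_ae_map (by fun_prop) hω

lemma IsVelocity.neg {P : Measure Env} (hR : ReflectionInvariant P) {lam v : ℝ}
    (h : IsVelocity P lam v) : IsVelocity P (-lam) (-v) := by
  filter_upwards [ae_reflect hR h] with ω hω
  filter_upwards [hω] with X hX
  simpa [neg_div] using hX.neg

lemma isVelocity_zero {P : Measure Env} [IsProbabilityMeasure P] (hP : Ergodic shift P)
    (hR : ReflectionInvariant P) {lam : ℝ} (h : 0 ≤ lam) (hm : meanSbar P lam = ∞) :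
    IsVelocity P lam 0 := by
  refine isVelocity_of_bounds (fun c hc => ae_eventually_walk_le hP hc (by simp [hm]))
    fun c hc => ?_
  -- The upper bound at bias -λ, with positive slope -c, becomes under reflection the lower bound at
  -- λ.
  have h1 := ae_eventually_walk_le hP (lam := -lam) (c := -c) (by linarith)
    (by simp [meanSbar_neg_eq_top hP.toMeasurePreserving hR h])
  have h2 := ae_reflect hR h1
  rw [neg_neg] at h2
  filter_upwards [h2] with ω hω
  filter_upwards [hω] with X hX
  filter_upwards [hX] with n hn
  simp only [Pi.neg_apply, Int.cast_neg] at hn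
  linarith

lemma IsVelocity.vX_eq {P : Measure Env} [IsProbabilityMeasure P] {lam v : ℝ}
    (h : IsVelocity P lam v) : vX P lam = v :=
  (Classical.epsilon_spec (p := IsVelocity P lam) ⟨v, h⟩).unique h

/-- The `n`-th derivative of an odd function is odd or even, depending on the parity of `n`. -/
lemma HasNthDerivAt.comp_neg {f : ℝ → ℝ} (hf : ∀ x, f x = -f (-x)) {n : ℕ} {x d : ℝ}
    (h : HasNthDerivAt n f x d) : HasNthDerivAt n f (-x) ((-1) ^ (n + 1) * d) := by
  induction n generalizing x d with
  | zero =>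
    have h : f x = d := h
    change f (-x) = _
    have := hf (-x)
    rw [neg_neg] at this
    rw [this, h]
    ring
  | succ n ih =>
    obtain ⟨g, hg, hd⟩ := h
    refine ⟨fun y => (-1) ^ (n + 1) * g (-y), ?_, ?_⟩
    · have : Tendsto (fun y : ℝ => -y) (𝓝 (-x)) (𝓝 x) := by
        simpa using (continuous_neg (G := ℝ)).tendsto (-x)
      filter_upwards [this.eventually hg] with y hy
      simpa using ih hy
    · have hd' : HasDerivAt g d (-(-x)) := by rwa [neg_neg]
      have := ((hd'.scomp (-x) (hasDerivAt_neg (-x))).const_mul ((-1 : ℝ) ^ (n + 1)))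
      refine this.congr_deriv ?_
      simp [pow_succ]

lemma HasNthDerivAt.unique {f : ℝ → ℝ} {n : ℕ} {x d e : ℝ}
    (h : HasNthDerivAt n f x d) (h' : HasNthDerivAt n f x e) : d = e := by
  induction n generalizing x d e with
  | zero => exact Eq.trans (Eq.symm h) h'
  | succ n ih =>
    obtain ⟨g, hg, hd⟩ := h
    obtain ⟨g', hg', hd'⟩ := h'
    have : g =ᶠ[𝓝 x] g' := by
      filter_upwards [hg, hg'] with y h1 h2 using ih h1 h2
    exact hd.unique (hd'.congr_of_eventuallyEq this)

end Final

end RWRE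

theorem proposition3p6 (P : MeasureTheory.Measure RWRE.Env)
    [MeasureTheory.IsProbabilityMeasure P]
    (hP : RWRE.MainAssumption P) (hR : RWRE.ReflectionInvariant P) :
    (∀ lam : ℝ, RWRE.IsVelocity P lam (RWRE.vX P lam)) ∧
    (∀ lam : ℝ, RWRE.vX P lam = -RWRE.vX P (-lam)) ∧
    RWRE.vX P 0 = 0 ∧
    (∀ n : ℕ, Even n → ∀ d : ℝ, RWRE.HasNthDerivAt n (RWRE.vX P) 0 d → d = 0) ∧
    (∀ lam : ℝ, 0 ≤ lam →
      (RWRE.meanSbar P lam < ∞ →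
        RWRE.vX P lam = 1 / (RWRE.meanSbar P lam).toReal ∧ 0 < RWRE.vX P lam) ∧
      (RWRE.meanSbar P lam = ∞ → RWRE.vX P lam = 0)) := by
  have hE := hP.ergodic
  have hex_nonneg : ∀ lam : ℝ, 0 ≤ lam → ∃ v, RWRE.IsVelocity P lam v := by
    intro lam h
    by_cases hm : RWRE.meanSbar P lam = ∞
    · exact ⟨0, RWRE.isVelocity_zero hE hR h hm⟩
    · exact ⟨_, RWRE.isVelocity_of_meanSbar_ne_top hE hm⟩
  have hvel : ∀ lam : ℝ, RWRE.IsVelocity P lam (RWRE.vX P lam) := by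
    intro lam
    refine Classical.epsilon_spec (p := RWRE.IsVelocity P lam) ?_
    rcases le_total 0 lam with h | h
    · exact hex_nonneg lam h
    · obtain ⟨v, hv⟩ := hex_nonneg (-lam) (by linarith)
      have := hv.neg hR
      rw [neg_neg] at this
      exact ⟨_, this⟩
  have hodd : ∀ lam : ℝ, RWRE.vX P lam = -RWRE.vX P (-lam) := by
    intro lam
    have := (hvel (-lam)).neg hR
    rw [neg_neg] at this
    exact this.vX_eq
  refine ⟨hvel, hodd, ?_, ?_, ?_⟩
  · have := hodd 0
    rw [neg_zero] at this
    linarith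
  · intro n hn d hd
    -- Since n + 1 is odd and 0 is fixed by reflection, -d is also an n-th derivative at 0;
    -- uniqueness gives d = -d.
    have h := RWRE.HasNthDerivAt.comp_neg hodd hd
    rw [neg_zero, pow_succ, hn.neg_one_pow] at h
    have := hd.unique h
    linarith
  · intro lam h
    refine ⟨fun hm => ?_, fun hm => (RWRE.isVelocity_zero hE hR h hm).vX_eq⟩
    have e := (RWRE.isVelocity_of_meanSbar_ne_top hE hm.ne).vX_eq
    refine ⟨e, e ▸ one_div_pos.2 (ENNReal.toReal_pos ?_ hm.ne)⟩
    exact (zero_lt_one.trans_le (RWRE.one_le_meanSbar hE.toMeasurePreserving lam)).ne'
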